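/- Let $\alpha\in\mathbb C$, $\theta\in\mathbb R$ and let $p\ge 0$ be an integer. A shifted convolution quadrature (SCQ) with shift $\theta$, convolution weights $(\omega_j)_{j\ge 0}\subset\mathbb C$ and starting weights $w_{n,j}$ approximates $(I^\alpha f)(x)$ at the node $x=x_{n-\theta}=(n-\theta)h$ by $$\Omega_h^\alpha f(x)+h^\alpha\sum_{j=0}^{s}w_{n,j}f(jh),\qquad \Omega_h^\alpha f(x)=h^\alpha\sum_{j=0}^{n}\omega_j f\big(x+(\theta-j)h\big),$$ where $I^\alpha$ is the Riemann--Liouville operator: $I^\alpha f(x)=\frac1{\Gamma(\alpha)}\int_0^x(x-s)^{\alpha-1}f(s)\,ds$ if $\Re\alpha>0$, $I^0$ is the identity, and otherwise $I^\alpha f=\frac{d^k}{dx^k}I^{k+\alpha}f$ with $k=\lfloor-\Re\alpha\rfloor+1$. For $\Re\beta\le 0$, $\beta\ne 0,-1,-2,\dots$, the function $t^{\beta-1}$ is understood as a finite part, i.e. $I^\alpha t^{\beta-1}=\frac{\Gamma(\beta)}{\Gamma(\beta+m)}\frac{d^m}{dx^m}I^\alpha t^{\beta+m-1}$ with $m=\lfloor-\Re\beta\rfloor+1$.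 In sums, the value of $t^{\beta-1}$ at $t=0$ is $1$ if $\beta=1$ and $0$ if $\beta\neq1$. Put $E_h^\alpha=\Omega_h^\alpha-I^\alpha$ and $\omega(\xi)=\sum_{j\ge0}\omega_j\xi^j$. Suppose that $\omega$ satisfies Condition-$\omega$: the series converges to an analytic function without zeros in $D=\{|\xi|<1\}$, and there $$\omega(\xi)=\nu(\xi)\prod_{j=0}^{\ell}\Big(1-\frac{\xi}{\xi_j}\Big)^{-\alpha_j}\quad\text{(principal powers)},\qquad \xi_0=1,\ \alpha_0=\alpha,$$ where the $\xi_j$ are distinct, $|\xi_j|=1$, $\nu$ is analytic on the closed disc $\overline D$ (i.e. on a neighbourhood of it), $\nu(\xi_j)\neq0$ and $\Re\alpha_j\le\Re\alpha$ for all $j$, and $\alpha_j\notin\{0,-1,-2,\dots\}$ for $j\ge1$. Then the following are equivalent: (a) the SCQ is convergent of order $p$ to $I^\alpha$: for every $\beta\in\mathbb C\setminus\{0,-1,-2,\dots\}$, $$(E_h^\alpha t^{\beta-1})(1)=O(h^\beta)+O(h^p)$$ as $h\to0$ through the step sizes $h=1/(n-\theta)$, $n\in\mathbb N$, for which $x=1$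 is the node $x_{n-\theta}$; (b) the SCQ is stable, $\omega_n=O(n^{\alpha-1})$ as $n\to\infty$, and consistent of order $p$, $h^\alpha e^{\theta h}\omega(e^{-h})=1+O(h^p)$ as $h\to0^+$. -/

import Mathlib

open Filter Topology Asymptotics

noncomputable section

/-- The Riemann-Liouville integral `(1 / Γ(α)) ∫₀ˣ (x - s)^(α - 1) f(s) ds`, used for `0 < Re α`. -/
def rlIntegral (α : ℂ) (f : ℝ → ℂ) (x : ℝ) : ℂ :=
  (1 / Complex.Gamma α) * ∫ s in (0 : ℝ)..x, ((x - s : ℝ) : ℂ) ^ (α - 1) * f s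

/-- The Riemann-Liouville operator `I^α` for arbitrary `α ∈ ℂ`: the integral if `0 < Re α`, the
identity if `α = 0`, and otherwise `(d/dx)^n I^(n + α)` with `n = ⌊-Re α⌋ + 1`, the least natural
number for which `n + α` has positive real part. -/
def rlOperator (α : ℂ) (f : ℝ → ℂ) (x : ℝ) : ℂ :=
  if 0 < α.re then rlIntegral α f x
  else if α = 0 then f x
  else iteratedDeriv (⌊-α.re⌋₊ + 1) (rlIntegral (α + (⌊-α.re⌋₊ + 1 : ℕ)) f) x

/-- The power function `t ↦ t^(β - 1)` on `[0, ∞)`. At `t = 0` it has the value `1` if `β = 1`, and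
`0` if `β ≠ 1` (for `Re β ≤ 1`, `β ≠ 1`, where there is no natural value, this is a convention). -/
def powFun (β : ℂ) (t : ℝ) : ℂ := (t : ℂ) ^ (β - 1)

/-- `(I^α t^(β - 1))(x)` for `β ≠ 0, -1, -2, …`. If `0 < Re β` this is the operator `rlOperator`
applied to the power function. If `Re β ≤ 0` the power function is not integrable at `0` and stands,
as usual, for its finite part `t^(β - 1) = Γ(β) / Γ(β + m) (d/dt)^m t^(β + m - 1)`, with
`m = ⌊-Re β⌋ + 1` (so that `0 < Re (β + m)`), and `I^α` commutes with this derivative. -/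
def rlPow (α β : ℂ) (x : ℝ) : ℂ :=
  if 0 < β.re then rlOperator α (powFun β) x
  else
    (Complex.Gamma β / Complex.Gamma (β + (⌊-β.re⌋₊ + 1 : ℕ))) *
      iteratedDeriv (⌊-β.re⌋₊ + 1)
        (fun y => rlOperator α (powFun (β + (⌊-β.re⌋₊ + 1 : ℕ))) y) x

/-- A shifted convolution quadrature: the shift `θ`, the convolution weights `ω_j`, and the starting
weights `w_{n,j}`, `0 ≤ j ≤ s`. -/
structure SCQ where
  /-- the shift parameter -/
  θ : ℝ
  /-- the convolution weights -/
  ω : ℕ → ℂ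
  /-- the index of the last starting weight -/
  s : ℕ
  /-- the starting weights -/
  w : ℕ → ℕ → ℂ

namespace SCQ

/-- The shifted node `x_{n-θ} = (n - θ) h`. -/
def node (Q : SCQ) (h : ℝ) (n : ℕ) : ℝ := (n - Q.θ) * h

/-- The convolution part `h^α ∑_{j=0}^n ω_j f(x + (θ - j) h)` at `x = x_{n-θ}`. -/
def convPart (Q : SCQ) (α : ℂ) (h : ℝ) (n : ℕ) (f : ℝ → ℂ) : ℂ :=
  (h : ℂ) ^ α * ∑ j ∈ Finset.range (n + 1), Q.ω j * f (Q.node h n + (Q.θ - j) * h)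

/-- The starting part `h^α ∑_{j=0}^s w_{n,j} f(j h)`. -/
def startPart (Q : SCQ) (α : ℂ) (h : ℝ) (n : ℕ) (f : ℝ → ℂ) : ℂ :=
  (h : ℂ) ^ α * ∑ j ∈ Finset.range (Q.s + 1), Q.w n j * f (j * h)

/-- The quadrature: the approximation of `(I^α f)(x_{n-θ})`. -/
def approx (Q : SCQ) (α : ℂ) (h : ℝ) (n : ℕ) (f : ℝ → ℂ) : ℂ :=
  Q.convPart α h n f + Q.startPart α h n f

/-- The convolution quadrature error `(E_h^α t^(β - 1))(x)` at `x = x_{n-θ}` (the error of the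
convolution part alone). -/
def powError (Q : SCQ) (α β : ℂ) (h : ℝ) (n : ℕ) : ℂ :=
  Q.convPart α h n (powFun β) - rlPow α β (Q.node h n)

/-- The generating function `ω(ξ) = ∑ ω_j ξ^j`. -/
def genFun (Q : SCQ) (ξ : ℂ) : ℂ := ∑' j : ℕ, Q.ω j * ξ ^ j

/-- Stability for `I^α`: `ω_n = O(n^(α - 1))`. -/
def Stable (Q : SCQ) (α : ℂ) : Prop :=
  Q.ω =O[atTop] fun n : ℕ => (n : ℂ) ^ (α - 1)

/-- Consistency of order `p` for `I^α`: `h^α e^(θ h) ω(e^(-h)) = 1 + O(h^p)` as `h → 0+`. -/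
def ConsistentOfOrder (Q : SCQ) (α : ℂ) (p : ℕ) : Prop :=
  (fun h : ℝ => (h : ℂ) ^ α * Complex.exp (Q.θ * h) * Q.genFun (Complex.exp (-h)) - 1)
    =O[𝓝[>] 0] fun h : ℝ => h ^ p

/-- Convergence of order `p` to `I^α`: `(E_h^α t^(β - 1))(1) = O(h^β) + O(h^p)` for all
`β ≠ 0, -1, -2, …`. The step sizes are those for which `1` is a node `x_{n-θ}`, that is
`h = 1 / (n - θ)`, and `n → ∞`. -/
def ConvergentOfOrder (Q : SCQ) (α : ℂ) (p : ℕ) : Prop :=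
  ∀ β : ℂ, (∀ m : ℕ, β ≠ -(m : ℂ)) →
    (fun n : ℕ => Q.powError α β (1 / (n - Q.θ)) n)
      =O[atTop] fun n : ℕ => (1 / (n - Q.θ)) ^ β.re + (1 / (n - Q.θ)) ^ p

/-- The admissible generating functions: `ω` is analytic and without zeros in the open unit disc `D`
and, there, `ω(ξ) = ν(ξ) ∏_{j=0}^ℓ (ξ - ξ_j)^(-α_j)` with `ξ_0 = 1`, `α_0 = α`, distinct `ξ_j` of
modulus one, `ν` analytic on the closed disc, `ν(ξ_j) ≠ 0`, `α_j ≠ 0, -1, …` for `j ≥ 1`, and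
`Re α_j ≤ Re α`. The branch of `(ξ - ξ_j)^(-α_j)` has to be analytic in `D`; up to a constant
factor, which `ν` absorbs, it is the principal power of `1 - ξ / ξ_j`, which has positive real
part. -/
structure ConditionOmega (Q : SCQ) (α : ℂ) : Prop where
  summable : ∀ ξ : ℂ, ‖ξ‖ < 1 → Summable fun j : ℕ => Q.ω j * ξ ^ j
  ne_zero : ∀ ξ : ℂ, ‖ξ‖ < 1 → Q.genFun ξ ≠ 0
  factorization : ∃ (l : ℕ) (sing a : Fin (l + 1) → ℂ) (ν : ℂ → ℂ),
    sing 0 = 1 ∧ a 0 = α ∧ Function.Injective sing ∧ (∀ j, ‖sing j‖ = 1) ∧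
    AnalyticOnNhd ℂ ν (Metric.closedBall 0 1) ∧ (∀ j, ν (sing j) ≠ 0) ∧
    (∀ j, j ≠ 0 → ∀ m : ℕ, a j ≠ -(m : ℂ)) ∧ (∀ j, (a j).re ≤ α.re) ∧
    ∀ ξ : ℂ, ‖ξ‖ < 1 → Q.genFun ξ = ν ξ * ∏ j, (1 - ξ / sing j) ^ (-(a j))

end SCQ

end

/-! The shift cancels in the sample points, so up to a power of h the convolution part applied to
t^(β-1) is the n-th coefficient of `ω(X) * ∑ n^(β-1) X^n`. The theorem is read off from the
asymptotics of this coefficient, that is, from the singularities of the product on the unit circle.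

Put u = 1 - e^(-h) and let `shiftPow s θ` be (h/u)^(-s) e^(-θh) as an analytic function of u. Its
Taylor coefficients c_k give the expansion (n-θ)^(s-1)/Γ(s) ~ ∑ c_k b_n(s-k), where b_n(a) are the
coefficients of (1-X)^(-a) (`hasBinExpansion`). For Re s < 1 this is Watson's lemma, both sides
being Laplace integrals; a recursion s → s+1 gives the rest. With θ = 0 it shows that the samples of
the power function have generating series Γ(β)(1-X)^(-β) times a polynomial, up to rapidly decaying
coefficients (`mk_powFun_eq`).

A Bézout identity between the K-th powers of the factors 1 - z_i X acts as a partition of unity and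
separates the singularities. Those away from 1 contribute O(n^(α-1)), since Re α_j ≤ Re α. At 1 the
remaining factor is expanded in powers of 1-X, and its coefficients are identified by letting ξ → 1
along the real axis (`Factored.expansion_coeff`). If h^α e^(θh) ω(e^(-h)) = 1 + γ u^q + O(u^(q+1)),
they are the Taylor coefficients of `shiftPow (α+β) θ`, with γ added to the q-th. By
`hasBinExpansion` with s = α+β the former reassemble to the exact value of the integral, so the
error is a constant times γ h^(α+β-1) b_n(α+β-q), up to O(h^(q+1)) + O(h^β) (`powError_isBigO`).

As b_n(a) = O(n^(a-1)), the γ term is O(h^q), so consistency of order p gives convergence of order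
p. Conversely, stability follows from the factorization alone. Convergence of order p, tested on one
suitable β, forces γ = 0 for each q < p (`leading_term_eq_zero`), and induction on q gives
consistency of order p. -/

namespace ConvQuad

/-! ### Binomial series and their coefficients -/

section

open PowerSeries

/-- The power series of `(1 - z X)^(-a)`. -/
noncomputable def negBin (z a : ℂ) : ℂ⟦X⟧ :=
  rescale (-z) (PowerSeries.binomialSeries ℂ (-a))

theorem negBin_add (z a b : ℂ) : negBin z (a + b) = negBin z a * negBin z b := by
  rw [negBin, neg_add, PowerSeries.binomialSeries_add, map_mul]; rfl

theorem negBin_zero (z : ℂ) : negBin z 0 = 1 := by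
  simp [negBin]

theorem negBin_neg_natCast (z : ℂ) (k : ℕ) : negBin z (-(k : ℂ)) = (1 - C z * X) ^ k := by
  rw [negBin, neg_neg, PowerSeries.binomialSeries_nat, map_pow, map_add, map_one, rescale_X]
  simp [sub_eq_add_neg]

theorem negBin_one_neg_natCast (k : ℕ) : negBin 1 (-(k : ℂ)) = (1 - X) ^ k := by
  simp [negBin_neg_natCast]

/-- The coefficients of `(1 - X)^(-a)`. -/
noncomputable def bc (a : ℂ) (n : ℕ) : ℂ := coeff n (negBin 1 a)

theorem bc_eq_prod (a : ℂ) (n : ℕ) :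
    bc a n = (∏ j ∈ Finset.range n, (a + j)) / n.factorial := by
  rw [bc, negBin, coeff_rescale, PowerSeries.binomialSeries_coeff, Ring.choose_eq_smul]
  simp only [smul_eq_mul, mul_one]
  have : ((descPochhammer ℤ n).smeval (-a) : ℂ) = (-1) ^ n * ∏ j ∈ Finset.range n, (a + j) := by
    induction n with
    | zero => simp
    | succ n ih =>
      rw [descPochhammer_succ_right, Polynomial.smeval_mul, ih, Finset.prod_range_succ]
      simp [Polynomial.smeval_natCast]
      ring
  rw [this, div_eq_mul_inv, mul_left_comm, ← mul_assoc ((-1) ^ n), ← mul_pow]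
  simp [mul_comm]

theorem coeff_negBin (z a : ℂ) (n : ℕ) : coeff n (negBin z a) = z ^ n * bc a n := by
  rw [bc, negBin, negBin, coeff_rescale, coeff_rescale, ← mul_assoc, ← mul_pow]
  simp

theorem bc_succ (a : ℂ) (n : ℕ) : (n + 1) * bc a (n + 1) = (a + n) * bc a n := by
  have : (n.factorial : ℂ) ≠ 0 := by exact_mod_cast n.factorial_ne_zero
  have h2 : (n + 1 : ℂ) ≠ 0 := by exact_mod_cast n.succ_ne_zero
  rw [bc_eq_prod, bc_eq_prod, Finset.prod_range_succ, Nat.factorial_succ]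
  push_cast
  field_simp

theorem bc_zero_right (a : ℂ) : bc a 0 = 1 := by simp [bc_eq_prod]

theorem bc_one_left (n : ℕ) : bc 1 n = 1 := by
  induction n with
  | zero => exact bc_zero_right 1
  | succ n ih =>
    have h2 : (n + 1 : ℂ) ≠ 0 := by exact_mod_cast n.succ_ne_zero
    have := bc_succ 1 n
    rw [ih, add_comm (1 : ℂ)] at this
    exact mul_left_cancel₀ h2 this

theorem bc_neg_natCast {k n : ℕ} (h : k < n) : bc (-(k : ℂ)) n = 0 := by
  rw [bc_eq_prod, Finset.prod_eq_zero (Finset.mem_range.2 h) (by simp), zero_div]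

/-- `n b_n(a) = a (b_n(a + 1) - b_n(a))`. -/
theorem natCast_mul_bc (a : ℂ) (n : ℕ) : n * bc a n = a * (bc (a + 1) n - bc a n) := by
  suffices h : a * bc (a + 1) n = (a + n) * bc a n by rw [mul_sub, h]; ring
  induction n with
  | zero => simp [bc_zero_right]
  | succ n ih =>
    have h2 : (n + 1 : ℂ) ≠ 0 := by exact_mod_cast n.succ_ne_zero
    apply mul_left_cancel₀ h2
    have h3 := bc_succ a n
    have h4 := bc_succ (a + 1) n
    push_cast
    linear_combination a * h4 + (a + 1 + n) * ih - (a + n + 1) * h3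

theorem bc_eq_gammaSeq {a : ℂ} (ha : ∀ m : ℕ, a ≠ -(m : ℂ)) {n : ℕ} (hn : n ≠ 0) :
    bc a n = (n : ℂ) ^ a / (a + n) * (Complex.GammaSeq a n)⁻¹ := by
  have h0 : ∀ j : ℕ, a + j ≠ 0 := fun j h => ha j (eq_neg_of_add_eq_zero_left h)
  have h1 : ∏ j ∈ Finset.range n, (a + j) ≠ 0 := Finset.prod_ne_zero_iff.2 fun j _ => h0 j
  have h2 : (n.factorial : ℂ) ≠ 0 := by exact_mod_cast n.factorial_ne_zero
  have h3 : (n : ℂ) ^ a ≠ 0 := by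
    rw [Ne, Complex.cpow_eq_zero_iff]; simp [hn]
  have := h0 n
  rw [bc_eq_prod, Complex.GammaSeq, Finset.prod_range_succ]
  field_simp

/-- Euler's limit formula for Γ, inverted: `bc a n` is n^a / (a + n) divided by `Complex.GammaSeq a
n`. Away from the poles this gives the exact order of growth, not only an upper bound. -/
theorem tendsto_bc {a : ℂ} (ha : ∀ m : ℕ, a ≠ -(m : ℂ)) :
    Tendsto (fun n : ℕ => bc a n / (n : ℂ) ^ (a - 1)) atTop (𝓝 (Complex.Gamma a)⁻¹) := by
  have h1 : Tendsto (fun n : ℕ => (n : ℂ) / (a + n)) atTop (𝓝 1) := by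
    have h : Tendsto (fun n : ℕ => (a / (n : ℂ) + 1)⁻¹) atTop (𝓝 (0 + 1)⁻¹) := by
      refine (Tendsto.add ?_ tendsto_const_nhds).inv₀ (by simp)
      exact tendsto_const_div_atTop_nhds_zero_nat a
    rw [zero_add, inv_one] at h
    refine h.congr' ?_
    filter_upwards [eventually_ne_atTop 0] with n hn
    have : (n : ℂ) ≠ 0 := by exact_mod_cast hn
    rw [div_add_one this, inv_div]
  have h2 := (Complex.GammaSeq_tendsto_Gamma a).inv₀ (Complex.Gamma_ne_zero ha)
  have h3 := h1.mul h2
  rw [one_mul] at h3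
  refine h3.congr' ?_
  filter_upwards [eventually_ne_atTop 0] with n hn
  have : (n : ℂ) ≠ 0 := by exact_mod_cast hn
  have h4 : (n : ℂ) ^ a ≠ 0 := by
    rw [Ne, Complex.cpow_eq_zero_iff]; simp [hn]
  rw [bc_eq_gammaSeq ha hn, Complex.cpow_sub _ _ this, Complex.cpow_one]
  field_simp

/-! ### Polynomial growth of coefficients -/

/-- `F` has coefficients of size `O((n + 1)^a)`. -/
def Bd (F : ℂ⟦X⟧) (a : ℝ) : Prop := ∃ C : ℝ, ∀ n : ℕ, ‖coeff n F‖ ≤ C * ((n : ℝ) + 1) ^ a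

theorem Bd.mono {F : ℂ⟦X⟧} {a b : ℝ} (h : Bd F a) (hab : a ≤ b) : Bd F b := by
  obtain ⟨C, hC⟩ := h
  refine ⟨|C|, fun n => (hC n).trans ?_⟩
  have h1 : (1 : ℝ) ≤ (n : ℝ) + 1 := by simp
  gcongr
  · exact le_abs_self C

theorem Bd.add {F G : ℂ⟦X⟧} {a : ℝ} (hF : Bd F a) (hG : Bd G a) : Bd (F + G) a := by
  obtain ⟨C, hC⟩ := hF
  obtain ⟨D, hD⟩ := hG
  refine ⟨C + D, fun n => ?_⟩
  rw [map_add, add_mul]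
  exact (norm_add_le _ _).trans (add_le_add (hC n) (hD n))

theorem Bd.sum {ι : Type*} (s : Finset ι) {F : ι → ℂ⟦X⟧} {a : ℝ} (h : ∀ i ∈ s, Bd (F i) a) :
    Bd (∑ i ∈ s, F i) a := by
  classical
  induction s using Finset.induction_on with
  | empty => exact ⟨0, by simp⟩
  | insert i s hi ih =>
    rw [Finset.sum_insert hi]
    exact (h i (by simp)).add (ih fun j hj => h j (by simp [hj]))

/-- A Peetre-type inequality for convolutions, meant for x = n - j + 1, y = j + 1, z = n + 1:
replacing x by z costs only a power of y, whatever the sign of a. -/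
theorem rpow_conv_le (a : ℝ) {x y z : ℝ} (hx : 1 ≤ x) (hy : 1 ≤ y) (hxz : x ≤ z) (h : z ≤ x * y) :
    x ^ a ≤ z ^ a * y ^ |a| := by
  have hz : 0 < z := by linarith
  rcases le_or_gt 0 a with ha | ha
  · calc x ^ a ≤ z ^ a := Real.rpow_le_rpow (by linarith) hxz ha
      _ ≤ z ^ a * y ^ |a| := le_mul_of_one_le_right (by positivity) (Real.one_le_rpow hy (abs_nonneg a))
  · rw [abs_of_neg ha]
    have h1 : (x * y) ^ a ≤ z ^ a := Real.rpow_le_rpow_of_nonpos hz h ha.le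
    rw [Real.mul_rpow (by linarith) (by linarith)] at h1
    have h2 : y ^ a * y ^ (-a) = 1 := by rw [← Real.rpow_add (by linarith)]; simp
    have h3 : 0 < y ^ (-a) := by positivity
    calc x ^ a = x ^ a * y ^ a * y ^ (-a) := by rw [mul_assoc, h2, mul_one]
      _ ≤ _ := by gcongr

theorem summable_add_one_rpow_neg_two : Summable fun n : ℕ => ((n : ℝ) + 1) ^ (-2 : ℝ) := by
  have := (summable_nat_add_iff 1).2 (Real.summable_nat_rpow.2 (by norm_num : (-2 : ℝ) < -1))
  simpa using this

/-- A rapidly decaying factor does not change the growth exponent. Of its decay, |a| pays for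
`rpow_conv_le` and 2 makes the convolution sum converge. -/
theorem Bd.mul {F G : ℂ⟦X⟧} {a M : ℝ} (hF : Bd F a) (hG : Bd G (-M)) (hM : |a| + 2 ≤ M) :
    Bd (F * G) a := by
  obtain ⟨C, hC⟩ := hF
  obtain ⟨D, hD⟩ := hG
  have hC0 : 0 ≤ C := by simpa using (norm_nonneg _).trans (hC 0)
  have hD0 : 0 ≤ D := by simpa using (norm_nonneg _).trans (hD 0)
  have hs := summable_add_one_rpow_neg_two
  refine ⟨C * D * ∑' n : ℕ, ((n : ℝ) + 1) ^ (-2 : ℝ), fun n => ?_⟩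
  rw [mul_comm F, coeff_mul, Finset.Nat.sum_antidiagonal_eq_sum_range_succ
    (fun i j => coeff i G * coeff j F)]
  refine (norm_sum_le _ _).trans ?_
  have key : ∀ j ∈ Finset.range (n + 1), ‖coeff j G * coeff (n - j) F‖ ≤
      C * D * ((n : ℝ) + 1) ^ a * ((j : ℝ) + 1) ^ (-2 : ℝ) := by
    intro j hj
    have hj' : j ≤ n := Nat.lt_succ_iff.1 (Finset.mem_range.1 hj)
    rw [norm_mul]
    have h1 := hC (n - j)
    have h2 := hD j
    rw [Nat.cast_sub hj'] at h1
    have hjn : (j : ℝ) ≤ n := by exact_mod_cast hj'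
    have hj0 : (0 : ℝ) ≤ j := by positivity
    have h3 : ((n : ℝ) - j + 1) ^ a ≤ ((n : ℝ) + 1) ^ a * ((j : ℝ) + 1) ^ |a| :=
      rpow_conv_le a (by linarith) (by linarith) (by linarith) (by nlinarith)
    have h4 : ((j : ℝ) + 1) ^ |a| * ((j : ℝ) + 1) ^ (-M) ≤ ((j : ℝ) + 1) ^ (-2 : ℝ) := by
      rw [← Real.rpow_add (by linarith)]
      exact Real.rpow_le_rpow_of_exponent_le (by linarith) (by linarith)
    calc ‖coeff j G‖ * ‖coeff (n - j) F‖
        ≤ (D * ((j : ℝ) + 1) ^ (-M)) * (C * (((n : ℝ) + 1) ^ a * ((j : ℝ) + 1) ^ |a|)) := by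
          gcongr
          exact h1.trans (by gcongr)
      _ = C * D * ((n : ℝ) + 1) ^ a * (((j : ℝ) + 1) ^ |a| * ((j : ℝ) + 1) ^ (-M)) := by ring
      _ ≤ _ := by gcongr
  refine (Finset.sum_le_sum key).trans ?_
  rw [← Finset.mul_sum]
  have := hs.sum_le_tsum (Finset.range (n + 1)) (fun i _ => by positivity)
  calc _ ≤ C * D * ((n : ℝ) + 1) ^ a * ∑' n : ℕ, ((n : ℝ) + 1) ^ (-2 : ℝ) := by gcongr
    _ = _ := by ring

theorem Bd_of_isBigO {F : ℂ⟦X⟧} {a : ℝ}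
    (h : (fun n : ℕ => coeff n F) =O[atTop] fun n : ℕ => (n : ℝ) ^ a) : Bd F a := by
  have h1 : (fun n : ℕ => (n : ℝ) ^ a) =O[atTop] fun n : ℕ => ((n : ℝ) + 1) ^ a := by
    refine IsBigO.of_bound (2 ^ |a|) ?_
    filter_upwards [eventually_ge_atTop 1] with n hn
    have hn' : (1 : ℝ) ≤ n := by exact_mod_cast hn
    rw [Real.norm_of_nonneg (by positivity), Real.norm_of_nonneg (by positivity), mul_comm]
    exact rpow_conv_le a hn' (by norm_num) (by linarith) (by linarith)
  have h2 := h.trans h1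
  rw [← Nat.cofinite_eq_atTop] at h2
  obtain ⟨C, hC, h3⟩ := bound_of_isBigO_cofinite h2
  refine ⟨C, fun n => ?_⟩
  have := @h3 n (by positivity)
  rwa [Real.norm_of_nonneg (by positivity)] at this

theorem Bd.isBigO {F : ℂ⟦X⟧} {a : ℝ} (h : Bd F a) :
    (fun n : ℕ => coeff n F) =O[atTop] fun n : ℕ => (n : ℝ) ^ a := by
  obtain ⟨C, hC⟩ := h
  have hC0 : 0 ≤ C := by simpa using (norm_nonneg _).trans (hC 0)
  refine IsBigO.of_bound (C * 2 ^ |a|) ?_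
  filter_upwards [eventually_ge_atTop 1] with n hn
  have hn' : (1 : ℝ) ≤ n := by exact_mod_cast hn
  refine (hC n).trans ?_
  rw [Real.norm_of_nonneg (by positivity), mul_assoc]
  gcongr
  rcases le_or_gt 0 a with ha | ha
  · rw [abs_of_nonneg ha, ← Real.mul_rpow (by norm_num) (by positivity)]
    exact Real.rpow_le_rpow (by positivity) (by linarith) ha
  · calc ((n : ℝ) + 1) ^ a ≤ (n : ℝ) ^ a :=
        Real.rpow_le_rpow_of_nonpos (by positivity) (by linarith) ha.le
      _ ≤ _ := le_mul_of_one_le_left (by positivity) (Real.one_le_rpow (by norm_num) (abs_nonneg a))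

theorem natCast_cpow_isBigO (a : ℂ) :
    (fun n : ℕ => (n : ℂ) ^ a) =O[atTop] fun n : ℕ => (n : ℝ) ^ a.re := by
  refine IsBigO.of_bound 1 ?_
  filter_upwards [eventually_gt_atTop 0] with n hn
  rw [Complex.norm_natCast_cpow_of_pos hn, one_mul]
  exact le_abs_self _

theorem bc_isBigO (a : ℂ) : bc a =O[atTop] fun n : ℕ => (n : ℝ) ^ (a.re - 1) := by
  by_cases ha : ∀ m : ℕ, a ≠ -(m : ℂ)
  · have h1 := (tendsto_bc ha).isBigO_one ℝ
    have h2 := h1.mul (natCast_cpow_isBigO (a - 1))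
    simp only [one_mul, Complex.sub_re, Complex.one_re] at h2
    refine h2.congr' ?_ EventuallyEq.rfl
    filter_upwards [eventually_ne_atTop 0] with n hn
    have h4 : (n : ℂ) ^ (a - 1) ≠ 0 := by
      rw [Ne, Complex.cpow_eq_zero_iff]; simp [hn]
    rw [div_mul_cancel₀ _ h4]
  · push Not at ha
    obtain ⟨m, rfl⟩ := ha
    refine IsBigO.of_bound 0 ?_
    filter_upwards [eventually_gt_atTop m] with n hn
    simp [bc_neg_natCast hn]

theorem Bd_negBin {z : ℂ} (hz : ‖z‖ = 1) (a : ℂ) : Bd (negBin z a) (a.re - 1) := by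
  apply Bd_of_isBigO
  refine IsBigO.trans (IsBigO.of_bound 1 (Eventually.of_forall fun n => ?_)) (bc_isBigO a)
  rw [coeff_negBin, norm_mul, norm_pow, hz]
  simp

/-! ### Power series as functions on the unit disc -/

/-- On the open unit disc the power series `F` converges to `f`. -/
def Rep (F : ℂ⟦X⟧) (f : ℂ → ℂ) : Prop :=
  ∀ ξ : ℂ, ‖ξ‖ < 1 → HasSum (fun n : ℕ => coeff n F * ξ ^ n) (f ξ)

theorem Rep.add {F G : ℂ⟦X⟧} {f g : ℂ → ℂ} (hF : Rep F f) (hG : Rep G g) :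
    Rep (F + G) fun ξ => f ξ + g ξ := by
  intro ξ hξ
  simpa [add_mul] using (hF ξ hξ).add (hG ξ hξ)

theorem Rep.mul {F G : ℂ⟦X⟧} {f g : ℂ → ℂ} (hF : Rep F f) (hG : Rep G g) :
    Rep (F * G) fun ξ => f ξ * g ξ := by
  intro ξ hξ
  have h1 := hF ξ hξ
  have h2 := hG ξ hξ
  have e : (fun n => ∑ kl ∈ Finset.HasAntidiagonal.antidiagonal n,
      (coeff kl.1 F * ξ ^ kl.1) * (coeff kl.2 G * ξ ^ kl.2)) =
      fun n => coeff n (F * G) * ξ ^ n := by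
    funext n
    rw [coeff_mul, Finset.sum_mul]
    refine Finset.sum_congr rfl fun kl hkl => ?_
    rw [← Finset.HasAntidiagonal.mem_antidiagonal.1 hkl, pow_add]
    ring
  have s1 := h1.summable.norm
  have s2 := h2.summable.norm
  have h3 := tsum_mul_tsum_eq_tsum_sum_antidiagonal_of_summable_norm s1 s2
  have h4 := (summable_norm_sum_mul_antidiagonal_of_summable_norm s1 s2).of_norm
  rw [e] at h3 h4
  rw [h1.tsum_eq, h2.tsum_eq] at h3
  show HasSum _ (f ξ * g ξ)
  rw [h3]
  exact h4.hasSum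

theorem rep_polynomial (P : Polynomial ℂ) : Rep (P : ℂ⟦X⟧) fun ξ => P.eval ξ := by
  intro ξ _
  simp only [Polynomial.eval_eq_sum_range]
  simp only [Polynomial.coeff_coe]
  refine hasSum_sum_of_ne_finset_zero fun n hn => ?_
  rw [P.coeff_eq_zero_of_natDegree_lt (by simpa using hn), zero_mul]

theorem rep_one : Rep 1 fun _ => 1 := by
  simpa using rep_polynomial 1

theorem Rep.prod {ι : Type*} (s : Finset ι) {F : ι → ℂ⟦X⟧} {f : ι → ℂ → ℂ}
    (h : ∀ i ∈ s, Rep (F i) (f i)) : Rep (∏ i ∈ s, F i) fun ξ => ∏ i ∈ s, f i ξ := by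
  classical
  induction s using Finset.induction_on with
  | empty => simpa using rep_one
  | insert i s hi ih =>
    simp only [Finset.prod_insert hi]
    exact (h i (by simp)).mul (ih fun j hj => h j (by simp [hj]))

theorem Rep.hasFPowerSeriesAt {F : ℂ⟦X⟧} {f : ℂ → ℂ} (h : Rep F f) :
    HasFPowerSeriesAt f (FormalMultilinearSeries.ofScalars ℂ fun n => coeff n F) 0 := by
  rw [hasFPowerSeriesAt_iff]
  filter_upwards [Metric.ball_mem_nhds (0 : ℂ) one_pos] with z hz
  have := h z (by simpa using hz)
  simpa [mul_comm] using this

/-- The identity theorem for power series; it turns the factorization of the generating function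
into an identity in `ℂ⟦X⟧`. -/
theorem Rep.unique {F G : ℂ⟦X⟧} {f : ℂ → ℂ} (hF : Rep F f) (hG : Rep G f) : F = G := by
  have := hF.hasFPowerSeriesAt.eq_formalMultilinearSeries hG.hasFPowerSeriesAt
  ext n
  have h2 := congrArg (fun p => p.coeff n) this
  simpa using h2

theorem Rep.congr {F : ℂ⟦X⟧} {f g : ℂ → ℂ} (hF : Rep F f) (h : ∀ ξ : ℂ, ‖ξ‖ < 1 → f ξ = g ξ) :
    Rep F g := fun ξ hξ => h ξ hξ ▸ hF ξ hξ

theorem rep_negBin {z : ℂ} (hz : ‖z‖ = 1) (a : ℂ) :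
    Rep (negBin z a) fun ξ => (1 - z * ξ) ^ (-a) := by
  intro ξ hξ
  have h := (Complex.one_add_cpow_hasFPowerSeriesOnBall_zero (a := -a)).hasSum (y := -(z * ξ)) (by
    rw [← ENNReal.ofReal_one, Metric.eball_ofReal]
    simp [hz, hξ])
  rw [zero_add, ← sub_eq_add_neg] at h
  convert! h using 2 with n
  simp only [binomialSeries_apply, negBin, coeff_rescale, PowerSeries.binomialSeries_coeff,
    smul_eq_mul, List.ofFn_const, List.prod_replicate, mul_one]
  rw [neg_mul_eq_neg_mul, mul_pow]
  ring

/-! ### Expansion in powers of 1 - X -/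

/-- A series with rapidly decaying coefficients is divisible by
`1 - X` up to a constant. -/
theorem Bd.exists_eq_C_add {G : ℂ⟦X⟧} {M : ℝ} (hG : Bd G (-M)) (hM : 2 ≤ M) :
    ∃ (d : ℂ) (r : ℂ⟦X⟧), G = C d + (1 - X) * r ∧ Bd r (-(M - 2)) := by
  obtain ⟨D, hD⟩ := hG
  have hD0 : 0 ≤ D := by simpa using (norm_nonneg _).trans (hD 0)
  have hs := summable_add_one_rpow_neg_two
  have hb : ∀ k n : ℕ, ‖coeff (n + k) G‖ ≤
      D * ((k : ℝ) + 1) ^ (-(M - 2)) * ((n : ℝ) + 1) ^ (-2 : ℝ) := by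
    intro k n
    refine (hD _).trans ?_
    have hk : (0 : ℝ) ≤ k := by positivity
    have hn : (0 : ℝ) ≤ n := by positivity
    have e : -M = -(M - 2) + (-2) := by ring
    rw [mul_assoc, e, Real.rpow_add (by positivity)]
    push_cast
    refine mul_le_mul_of_nonneg_left (mul_le_mul ?_ ?_ (by positivity) (by positivity)) hD0
    · exact Real.rpow_le_rpow_of_nonpos (by positivity) (by linarith) (by linarith)
    · exact Real.rpow_le_rpow_of_nonpos (by positivity) (by linarith) (by norm_num)
  have hsum : ∀ k : ℕ, Summable fun n : ℕ => coeff (n + k) G := fun k =>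
    Summable.of_norm_bounded (hs.mul_left _) (hb k)
  -- The constant is G(1), and the coefficients of (G - G(1)) / (1 - X) are the negative tails of
  -- the series for G(1).
  refine ⟨∑' n, coeff n G, mk fun k => -∑' n, coeff (n + (k + 1)) G, ?_, ?_⟩
  · ext n
    rw [sub_mul, one_mul, map_add, map_sub]
    have key : ∀ k, ∑' n, coeff (n + k) G = coeff k G + ∑' n, coeff (n + (k + 1)) G := by
      intro k
      rw [(hsum k).tsum_eq_zero_add, zero_add]
      congr 1
      exact tsum_congr fun n => by rw [add_right_comm, add_assoc]
    cases n with
    | zero =>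
      have := key 0
      simp only [add_zero, zero_add] at this
      simp [coeff_zero_X_mul, this]
    | succ n =>
      have := key (n + 1)
      rw [coeff_succ_X_mul, coeff_mk, coeff_mk, coeff_C, this]
      simp
  · refine ⟨D * ∑' n : ℕ, ((n : ℝ) + 1) ^ (-2 : ℝ), fun k => ?_⟩
    rw [coeff_mk, norm_neg]
    refine (tsum_of_norm_bounded (hs.mul_left (D * (((k : ℕ) + 1 : ℕ) + 1 : ℝ) ^ (-(M - 2)))).hasSum
      (hb (k + 1))).trans ?_
    rw [tsum_mul_left, mul_right_comm]
    have hk : (0 : ℝ) ≤ k := by positivity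
    have h0 : 0 ≤ ∑' n : ℕ, ((n : ℝ) + 1) ^ (-2 : ℝ) := tsum_nonneg fun n => by positivity
    refine mul_le_mul_of_nonneg_left ?_ (by positivity)
    exact Real.rpow_le_rpow_of_nonpos (by positivity) (by push_cast; linarith) (by linarith)

/-- Repeated division by 1 - X: a Taylor expansion at the boundary point 1, where G need not be
analytic. Each division costs two powers of decay. -/
theorem Bd.exists_expansion {G : ℂ⟦X⟧} (m : ℕ) {M : ℝ} (hG : Bd G (-M)) (hM : 2 * m ≤ M) :
    ∃ (d : ℕ → ℂ) (r : ℂ⟦X⟧),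
      G = ∑ k ∈ Finset.range m, C (d k) * (1 - X) ^ k + (1 - X) ^ m * r ∧ Bd r (-(M - 2 * m)) := by
  induction m generalizing G M with
  | zero => exact ⟨0, G, by simp, by simpa using hG⟩
  | succ m ih =>
    push_cast at hM
    have hm : (0 : ℝ) ≤ m := by positivity
    obtain ⟨d₀, r₀, e₀, h₀⟩ := hG.exists_eq_C_add (by linarith)
    obtain ⟨d, r, e, h⟩ := ih h₀ (by linarith)
    refine ⟨fun k => Nat.casesOn k d₀ d, r, ?_, h.mono (by push_cast; linarith)⟩
    rw [Finset.sum_range_succ', e₀, e, mul_add, Finset.mul_sum]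
    simp only [pow_succ, pow_zero, mul_one]
    have h1 : ∑ i ∈ Finset.range m, (1 - X) * (C (d i) * (1 - X) ^ i) =
        ∑ i ∈ Finset.range m, C (d i) * ((1 - X) ^ i * (1 - X)) :=
      Finset.sum_congr rfl fun k _ => by ring
    rw [h1]
    change _ = _ + C d₀ + _
    ring

/-- A series with summable coefficients is bounded on the unit disc. -/
theorem Rep.bounded {F : ℂ⟦X⟧} {f : ℂ → ℂ} (h : Rep F f) (hF : Bd F (-2)) :
    ∃ C, ∀ ξ : ℂ, ‖ξ‖ < 1 → ‖f ξ‖ ≤ C := by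
  obtain ⟨D, hD⟩ := hF
  have hs := summable_add_one_rpow_neg_two
  refine ⟨∑' n : ℕ, D * ((n : ℝ) + 1) ^ (-2 : ℝ), fun ξ hξ => ?_⟩
  rw [← (h ξ hξ).tsum_eq]
  refine tsum_of_norm_bounded (hs.mul_left D).hasSum fun n => ?_
  rw [norm_mul, norm_pow]
  exact (mul_le_of_le_one_right (norm_nonneg _) (pow_le_one₀ (norm_nonneg _) hξ.le)).trans (hD n)

theorem Bd.exists_rep {F : ℂ⟦X⟧} (hF : Bd F (-2)) : ∃ f, Rep F f := by
  obtain ⟨D, hD⟩ := hF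
  have hs := summable_add_one_rpow_neg_two
  refine ⟨fun ξ => ∑' n, coeff n F * ξ ^ n, fun ξ hξ => Summable.hasSum ?_⟩
  refine Summable.of_norm_bounded (hs.mul_left D) fun n => ?_
  rw [norm_mul, norm_pow]
  exact (mul_le_of_le_one_right (norm_nonneg _) (pow_le_one₀ (norm_nonneg _) hξ.le)).trans (hD n)

end

/-! ### The function (h/u)^(-s) e^(-θh) of u = 1 - e^(-h) and its Taylor coefficients -/

section

/-- The Taylor coefficients at `0`. -/
noncomputable def tc (f : ℂ → ℂ) (k : ℕ) : ℂ := iteratedDeriv k f 0 / k.factorial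

theorem hasSum_tc {f : ℂ → ℂ} (hf : AnalyticAt ℂ f 0) :
    ∀ᶠ u in 𝓝 (0 : ℂ), HasSum (fun k => tc f k * u ^ k) (f u) := by
  have := hasFPowerSeriesAt_iff.1 hf.hasFPowerSeriesAt
  filter_upwards [this] with u hu
  simpa [mul_comm, tc] using hu

theorem tc_unique {f : ℂ → ℂ} {a b : ℕ → ℂ}
    (ha : ∀ᶠ u in 𝓝 (0 : ℂ), HasSum (fun k => a k * u ^ k) (f u))
    (hb : ∀ᶠ u in 𝓝 (0 : ℂ), HasSum (fun k => b k * u ^ k) (f u)) : a = b := by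
  have h1 : HasFPowerSeriesAt f (FormalMultilinearSeries.ofScalars ℂ a) 0 := by
    rw [hasFPowerSeriesAt_iff]
    filter_upwards [ha] with u hu
    simpa [mul_comm] using hu
  have h2 : HasFPowerSeriesAt f (FormalMultilinearSeries.ofScalars ℂ b) 0 := by
    rw [hasFPowerSeriesAt_iff]
    filter_upwards [hb] with u hu
    simpa [mul_comm] using hu
  funext n
  simpa using congrArg (fun p => p.coeff n) (h1.eq_formalMultilinearSeries h2)

theorem tc_deriv (f : ℂ → ℂ) (k : ℕ) : tc (deriv f) k = (k + 1) * tc f (k + 1) := by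
  have h1 : (k.factorial : ℂ) ≠ 0 := by exact_mod_cast k.factorial_ne_zero
  have h2 : (k + 1 : ℂ) ≠ 0 := by exact_mod_cast k.succ_ne_zero
  rw [tc, tc, iteratedDeriv_succ', Nat.factorial_succ]
  push_cast
  field_simp

theorem hasSum_tc_mul_deriv {f : ℂ → ℂ} (hf : AnalyticAt ℂ f 0) :
    ∀ᶠ u in 𝓝 (0 : ℂ), HasSum (fun k : ℕ => k * tc f k * u ^ k) (u * deriv f u) := by
  filter_upwards [hasSum_tc hf.deriv] with u hu
  rw [← hasSum_nat_add_iff' 1]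
  simp only [Finset.range_one, Finset.sum_singleton, Nat.cast_zero, zero_mul, sub_zero]
  convert! hu.mul_left u using 2 with k
  rw [tc_deriv]
  push_cast
  ring

theorem sub_sum_tc_isBigO {f : ℂ → ℂ} (hf : AnalyticAt ℂ f 0) (K : ℕ) :
    (fun u => f u - ∑ k ∈ Finset.range K, tc f k * u ^ k) =O[𝓝 0] fun u => ‖u‖ ^ K := by
  have := hf.hasFPowerSeriesAt.isBigO_sub_partialSum_pow K
  simpa [FormalMultilinearSeries.partialSum, tc, mul_comm] using this

/-- `-log (1 - u) / u`, extended analytically to `u = 0`. -/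
noncomputable def logQuot (u : ℂ) : ℂ := dslope (fun v => -Complex.log (1 - v)) 0 u

theorem analyticAt_log_one_sub : AnalyticAt ℂ (fun v : ℂ => -Complex.log (1 - v)) 0 :=
  ((analyticAt_const.sub analyticAt_id).clog (by simp)).neg

theorem analyticAt_logQuot : AnalyticAt ℂ logQuot 0 := by
  obtain ⟨p, hp⟩ := analyticAt_log_one_sub
  exact ⟨_, hp.has_fpower_series_dslope_fslope⟩

theorem logQuot_zero : logQuot 0 = 1 := by
  rw [logQuot, dslope_same]
  have : HasDerivAt (fun v : ℂ => -Complex.log (1 - v)) (-(-1 / (1 - 0))) 0 :=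
    (((hasDerivAt_id (0 : ℂ)).const_sub 1).clog (by simp)).neg
  rw [this.deriv]
  simp

theorem logQuot_of_ne {u : ℂ} (hu : u ≠ 0) : logQuot u = -Complex.log (1 - u) / u := by
  rw [logQuot, dslope_of_ne _ hu, slope_def_field]
  simp

/-- `(h / u)^(-s) e^(-θ h)` as a function of `u`, where `u = 1 - e^(-h)`. -/
noncomputable def shiftPow (s θ u : ℂ) : ℂ :=
  Complex.exp (-s * Complex.log (logQuot u) + θ * Complex.log (1 - u))

theorem shiftPow_add (s t θ η u : ℂ) :
    shiftPow (s + t) (θ + η) u = shiftPow s θ u * shiftPow t η u := by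
  rw [shiftPow, shiftPow, shiftPow, ← Complex.exp_add]
  ring_nf

theorem shiftPow_zero_zero (u : ℂ) : shiftPow 0 0 u = 1 := by simp [shiftPow]

theorem shiftPow_zero (s θ : ℂ) : shiftPow s θ 0 = 1 := by simp [shiftPow, logQuot_zero]

theorem analyticAt_shiftPow (s θ : ℂ) : AnalyticAt ℂ (shiftPow s θ) 0 := by
  refine AnalyticAt.cexp ((analyticAt_const.mul (analyticAt_logQuot.clog ?_)).add
    (analyticAt_const.mul ((analyticAt_const.sub analyticAt_id).clog ?_)))
  · simp [logQuot_zero]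
  · simp

/-- Since u^(-s) `shiftPow s θ u` = h^(-s) e^(-θh) and d/dh = (1 - u) d/du, differentiation in h
raises s by one. This is the counterpart of multiplying (n-θ)^(s-1) by n - θ. -/
theorem shiftPow_ode (s θ : ℂ) : ∀ᶠ u in 𝓝 (0 : ℂ),
    s * shiftPow (s + 1) θ u =
      (1 - u) * (s * shiftPow s θ u - u * deriv (shiftPow s θ) u) - θ * u * shiftPow s θ u := by
  have h1 : ∀ᶠ u in 𝓝 (0 : ℂ), logQuot u ∈ Complex.slitPlane :=
    analyticAt_logQuot.continuousAt.eventually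
      (Complex.isOpen_slitPlane.mem_nhds (by simp [logQuot_zero]))
  have h2 : ∀ᶠ u in 𝓝 (0 : ℂ), 1 - u ∈ Complex.slitPlane :=
    (continuousAt_const.sub continuousAt_id).eventually
      (Complex.isOpen_slitPlane.mem_nhds (by simp))
  have h3 : ∀ᶠ u in 𝓝 (0 : ℂ), AnalyticAt ℂ logQuot u := analyticAt_logQuot.eventually_analyticAt
  filter_upwards [h1, h2, h3] with u hu1 hu2 hu3
  rcases eq_or_ne u 0 with rfl | hu
  · simp [shiftPow_zero]
  have n1 : 1 - u ≠ 0 := Complex.slitPlane_ne_zero hu2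
  have n2 : logQuot u ≠ 0 := Complex.slitPlane_ne_zero hu1
  have d2 : HasDerivAt (fun v : ℂ => Complex.log (1 - v)) (-1 / (1 - u)) u :=
    ((hasDerivAt_id u).const_sub 1).clog hu2
  have d1 : HasDerivAt logQuot ((1 / (1 - u) - logQuot u) / u) u := by
    have h : HasDerivAt (fun v : ℂ => -Complex.log (1 - v) / v)
        ((-(-1 / (1 - u)) * u - -Complex.log (1 - u) * 1) / u ^ 2) u :=
      d2.neg.div (hasDerivAt_id u) hu
    have e : logQuot =ᶠ[𝓝 u] fun v : ℂ => -Complex.log (1 - v) / v := by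
      filter_upwards [isOpen_ne.mem_nhds hu] with v hv using logQuot_of_ne hv
    refine (h.congr_of_eventuallyEq e).congr_deriv ?_
    rw [logQuot_of_ne hu]
    field_simp
  have d3 : HasDerivAt (shiftPow s θ) (shiftPow s θ u *
      (-s * ((1 / (1 - u) - logQuot u) / u / logQuot u) + θ * (-1 / (1 - u)))) u :=
    (((d1.clog hu1).const_mul (-s)).add (d2.const_mul θ)).cexp
  have e1 : shiftPow (s + 1) θ u = shiftPow s θ u / logQuot u := by
    rw [shiftPow, shiftPow, eq_div_iff n2]
    nth_rewrite 2 [← Complex.exp_log n2]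
    rw [← Complex.exp_add]
    ring_nf
  rw [d3.deriv, e1]
  field_simp
  ring

theorem tc_shiftPow_zero (s θ : ℂ) : tc (shiftPow s θ) 0 = 1 := by
  simp [tc, shiftPow_zero]

theorem tc_shiftPow_succ (s θ : ℂ) (k : ℕ) :
    s * tc (shiftPow (s + 1) θ) (k + 1) =
      (s - (k + 1)) * tc (shiftPow s θ) (k + 1) - (s - k + θ) * tc (shiftPow s θ) k := by
  have A := analyticAt_shiftPow s θ
  set c := tc (shiftPow s θ) with hc
  -- The right side of `shiftPow_ode` regroups as (s f - u f') - u ((s + θ) f - u f'). The factor u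
  -- shifts the index by one, hence the 0 at k = 0.
  let e : ℕ → ℂ := fun k =>
    (s - k) * c k - Nat.casesOn k 0 fun j => (s - j + θ) * c j
  have h1 : ∀ᶠ u in 𝓝 (0 : ℂ),
      HasSum (fun k => e k * u ^ k) (s * shiftPow (s + 1) θ u) := by
    filter_upwards [hasSum_tc A, hasSum_tc_mul_deriv A, shiftPow_ode s θ] with u hu1 hu2 hu3
    have h2 := (hu1.mul_left s).sub hu2
    have h3 := ((hu1.mul_left (s + θ)).sub hu2).mul_left u
    have h4 : HasSum (fun k : ℕ => (Nat.casesOn k 0 fun j => (s - j + θ) * c j : ℂ) * u ^ k)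
        (u * ((s + θ) * shiftPow s θ u - u * deriv (shiftPow s θ) u)) := by
      rw [← hasSum_nat_add_iff' 1]
      simp only [Finset.range_one, Finset.sum_singleton]
      convert! h3 using 1
      · funext k
        ring
      · simp
    convert! h2.sub h4 using 1
    · funext k
      simp only [e, hc]
      ring
    · rw [hu3]
      ring
  have h2 : ∀ᶠ u in 𝓝 (0 : ℂ), HasSum (fun k => (s * tc (shiftPow (s + 1) θ) k) * u ^ k)
      (s * shiftPow (s + 1) θ u) := by
    filter_upwards [hasSum_tc (analyticAt_shiftPow (s + 1) θ)] with u hu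
    simpa [mul_assoc] using hu.mul_left s
  have := congrFun (tc_unique h2 h1) (k + 1)
  rw [this]
  simp [e]

/-- `u = 1 - e^(-h)` for real `h ≠ 0`. -/
theorem shiftPow_one_sub_exp {h : ℝ} (hh : h ≠ 0) (s θ : ℂ) :
    shiftPow s θ ((1 - Real.exp (-h) : ℝ) : ℂ) =
      Complex.exp (-s * Real.log (h / (1 - Real.exp (-h))) - θ * h) := by
  have h1 : (1 - Real.exp (-h) : ℝ) ≠ 0 := by
    rw [sub_ne_zero, ne_comm, Ne, Real.exp_eq_one_iff]
    simpa using hh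
  have h2 : ((1 - Real.exp (-h) : ℝ) : ℂ) ≠ 0 := by exact_mod_cast h1
  have h3 : (1 : ℂ) - ((1 - Real.exp (-h) : ℝ) : ℂ) = (Real.exp (-h) : ℝ) := by push_cast; ring
  have h4 : Complex.log ((Real.exp (-h) : ℝ) : ℂ) = ((-h : ℝ) : ℂ) := by
    rw [← Complex.ofReal_log (Real.exp_pos _).le, Real.log_exp]
  have h5 : 0 < h / (1 - Real.exp (-h)) := by
    rcases lt_or_gt_of_ne hh with h | h
    · exact div_pos_of_neg_of_neg h (by rw [sub_neg]; exact Real.one_lt_exp_iff.2 (by linarith))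
    · exact div_pos h (by rw [sub_pos]; exact Real.exp_lt_one_iff.2 (by linarith))
  rw [shiftPow, logQuot_of_ne h2, h3, h4]
  have h6 : -((-h : ℝ) : ℂ) / ((1 - Real.exp (-h) : ℝ) : ℂ) =
      ((h / (1 - Real.exp (-h)) : ℝ) : ℂ) := by push_cast; ring
  rw [h6, ← Complex.ofReal_log h5.le]
  push_cast
  ring_nf

end

/-! ### Laplace integrals and the binomial expansion for Re s < 1 -/

section

open MeasureTheory Set

theorem sub_exp_bounds (h : ℝ) :
    h ≤ Real.exp h - 1 ∧ Real.exp h - 1 ≤ h * Real.exp h := by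
  constructor
  · have := Real.add_one_le_exp h
    linarith
  · have h1 := Real.add_one_le_exp (-h)
    have h2 : Real.exp (-h) * Real.exp h = 1 := by rw [← Real.exp_add]; simp
    have h3 := Real.exp_pos h
    nlinarith

theorem rpow_exp_sub_one_le (a : ℝ) {h : ℝ} (hh : 0 < h) :
    (Real.exp h - 1) ^ a ≤ h ^ a * Real.exp (|a| * h) := by
  obtain ⟨h1, h2⟩ := sub_exp_bounds h
  have h0 : (0 : ℝ) < Real.exp h - 1 := by linarith
  rcases le_or_gt 0 a with ha | ha
  · rw [abs_of_nonneg ha, mul_comm a, Real.exp_mul, ← Real.mul_rpow hh.le (Real.exp_pos _).le]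
    exact Real.rpow_le_rpow h0.le h2 ha
  · refine (Real.rpow_le_rpow_of_nonpos hh h1 ha.le).trans ?_
    exact le_mul_of_one_le_right (by positivity) (Real.one_le_exp (by positivity))

/-- The estimate behind Watson's lemma: the majorant h^a e^(-(n-A)h) integrates to a Gamma value.
Exponential growth of g only shifts n, so a bound valid for all h > 0 suffices. -/
theorem eventually_laplace_bound {g : ℝ → ℂ} {C a A : ℝ} (ha : -1 < a)
    (hm : ContinuousOn g (Ioi 0)) (hg : ∀ h, 0 < h → ‖g h‖ ≤ C * h ^ a * Real.exp (A * h)) :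
    ∀ᶠ n : ℕ in atTop, IntegrableOn (fun h : ℝ => g h * Complex.exp (-(n * h))) (Ioi 0) ∧
      ‖∫ h : ℝ in Ioi 0, g h * Complex.exp (-(n * h))‖ ≤
        C * ((1 / (n - A)) ^ (a + 1) * Real.Gamma (a + 1)) := by
  filter_upwards [tendsto_natCast_atTop_atTop.eventually_gt_atTop A] with n hn
  have hr : 0 < n - A := sub_pos.2 hn
  have hi : IntegrableOn (fun h : ℝ => C * (h ^ a * Real.exp (-((n - A) * h)))) (Ioi 0) := by
    have := integrableOn_rpow_mul_exp_neg_mul_rpow ha one_pos hr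
    simp only [Real.rpow_one] at this
    refine Integrable.const_mul (this.congr_fun (fun h _ => ?_) measurableSet_Ioi) C
    ring_nf
  have hb : ∀ h ∈ Ioi (0 : ℝ), ‖g h * Complex.exp (-(n * h))‖ ≤
      C * (h ^ a * Real.exp (-((n - A) * h))) := by
    intro h hh
    rw [norm_mul, Complex.norm_exp]
    have e : (-((n : ℂ) * h)).re = -(n * h) := by simp
    rw [e]
    calc ‖g h‖ * Real.exp (-(n * h)) ≤ C * h ^ a * Real.exp (A * h) * Real.exp (-(n * h)) := by
          gcongr; exact hg h hh
      _ = C * (h ^ a * Real.exp (-((n - A) * h))) := by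
          rw [mul_assoc, ← Real.exp_add]; ring_nf
  have hint : IntegrableOn (fun h : ℝ => g h * Complex.exp (-(n * h))) (Ioi 0) := by
    refine Integrable.mono' hi ?_ ((ae_restrict_iff' measurableSet_Ioi).2 (Eventually.of_forall hb))
    refine ContinuousOn.aestronglyMeasurable (hm.mul ?_) measurableSet_Ioi
    fun_prop
  refine ⟨hint, ?_⟩
  refine (norm_integral_le_of_norm_le hi
    ((ae_restrict_iff' measurableSet_Ioi).2 (Eventually.of_forall hb))).trans ?_
  rw [integral_const_mul]
  have := Real.integral_rpow_mul_exp_neg_mul_Ioi (a := a + 1) (by linarith) hr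
  rw [add_sub_cancel_right] at this
  rw [this]

/-- The substitution x = e^(-h) turns this into the Beta integral B(n + s, 1 - s). -/
theorem laplace_exp_sub_one {s : ℂ} {n : ℕ} (hs : s.re < 1) (hn : 0 < n + s.re) :
    ∫ h : ℝ in Ioi 0, ((Real.exp h - 1 : ℝ) : ℂ) ^ (-s) * Complex.exp (-(n * h)) =
      Complex.Gamma (n + s) * Complex.Gamma (1 - s) / n.factorial := by
  have h1 := Complex.betaIntegral_eq_Gamma_mul_div (n + s) (1 - s) (by simpa using hn)
    (by simpa using hs)
  rw [show (n + s + (1 - s) : ℂ) = n + 1 by ring, Complex.Gamma_nat_eq_factorial] at h1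
  rw [← h1, Complex.betaIntegral, intervalIntegral.integral_of_le zero_le_one,
    integral_Ioc_eq_integral_Ioo]
  have himg : (fun h : ℝ => Real.exp (-h)) '' Ioi 0 = Ioo 0 1 := by
    ext x
    constructor
    · rintro ⟨h, hh, rfl⟩
      exact ⟨Real.exp_pos _, Real.exp_lt_one_iff.2 (neg_lt_zero.2 hh)⟩
    · rintro ⟨h0, h1⟩
      exact ⟨-Real.log x, neg_pos.2 (Real.log_neg h0 h1), by simp [Real.exp_log h0]⟩
  have hder : ∀ h ∈ Ioi (0 : ℝ),
      HasDerivWithinAt (fun h : ℝ => Real.exp (-h)) (-Real.exp (-h)) (Ioi 0) h := by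
    intro h _
    have := (hasDerivAt_neg h).exp
    simpa using this.hasDerivWithinAt
  have hinj : InjOn (fun h : ℝ => Real.exp (-h)) (Ioi 0) := fun x _ y _ hxy => by
    simpa using hxy
  rw [← himg, integral_image_eq_integral_abs_deriv_smul measurableSet_Ioi hder hinj]
  refine setIntegral_congr_fun measurableSet_Ioi fun h hh => ?_
  have hh : 0 < h := hh
  have hE : 0 < Real.exp h - 1 := hh.trans_le (sub_exp_bounds h).1
  have e1 : (1 : ℂ) - (Real.exp (-h) : ℝ) = ((Real.exp h - 1 : ℝ) : ℂ) * (Real.exp (-h) : ℝ) := by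
    rw [← Complex.ofReal_mul, sub_mul, ← Real.exp_add]
    simp
  have e2 : ∀ z : ℂ, ((Real.exp (-h) : ℝ) : ℂ) ^ z = Complex.exp (-(z * h)) := by
    intro z
    rw [Complex.cpow_def_of_ne_zero (by exact_mod_cast (Real.exp_pos _).ne'),
      ← Complex.ofReal_log (Real.exp_pos _).le, Real.log_exp]
    push_cast
    ring_nf
  simp only [abs_neg, abs_of_pos (Real.exp_pos _)]
  rw [e1, Complex.mul_cpow_ofReal_nonneg hE.le (Real.exp_pos _).le, e2, e2,
    show (1 - s - 1 : ℂ) = -s by ring, Complex.real_smul, Complex.ofReal_exp (-h)]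
  rw [mul_comm (_ ^ (-s)) (Complex.exp _), mul_comm (_ ^ (-s)) (Complex.exp _), ← mul_assoc,
    ← mul_assoc, ← Complex.exp_add, ← Complex.exp_add]
  push_cast
  ring_nf

theorem bc_eq_Gamma {a : ℂ} (ha : ∀ m : ℕ, a ≠ -(m : ℂ)) (n : ℕ) :
    bc a n = Complex.Gamma (n + a) / (Complex.Gamma a * n.factorial) := by
  have h1 : (n.factorial : ℂ) ≠ 0 := by exact_mod_cast n.factorial_ne_zero
  have h2 := Complex.Gamma_ne_zero ha
  rw [bc_eq_prod]
  have h3 : Complex.Gamma (n + a) = (∏ j ∈ Finset.range n, (a + j)) * Complex.Gamma a := by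
    induction n with
    | zero => simp
    | succ n ih =>
      rw [Finset.prod_range_succ, show ((n + 1 : ℕ) + a : ℂ) = (a + n) + 1 by push_cast; ring,
        Complex.Gamma_add_one, add_comm a, ih (by exact_mod_cast n.factorial_ne_zero)]
      · ring
      · intro h
        exact ha n (eq_neg_of_add_eq_zero_left h)
  rw [h3]
  field_simp

theorem ne_neg_natCast_sub {s : ℂ} (hs : s.re < 1) (h : ∀ m : ℕ, s ≠ -(m : ℂ)) (k m : ℕ) :
    s - k ≠ -(m : ℂ) := by
  intro e
  have e1 : s = ((k : ℤ) - m : ℤ) := by push_cast; linear_combination e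
  have e2 : s.re = ((k : ℤ) - m : ℤ) := by rw [e1, Complex.intCast_re]
  rw [e2] at hs
  have h3 : (k : ℤ) - m < 1 := by exact_mod_cast hs
  have h4 : (k : ℤ) ≤ m := by lia
  apply h (m - k)
  rw [e1, Nat.cast_sub (by lia)]
  push_cast
  ring

/-- By the reflection formula and the antiperiodicity of the sine. Thus the Laplace integrals of all
`bc (s - k) n` carry one common prefactor, the sign going into (1 - e^h)^k. -/
theorem Gamma_reflect_sub (s : ℂ) (k : ℕ) :
    Complex.Gamma (s - k) * Complex.Gamma (1 - (s - k)) =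
      (-1) ^ k * (Complex.Gamma s * Complex.Gamma (1 - s)) := by
  rw [Complex.Gamma_mul_Gamma_one_sub, Complex.Gamma_mul_Gamma_one_sub]
  have : Complex.sin (Real.pi * (s - k)) = (-1) ^ k * Complex.sin (Real.pi * s) := by
    rw [mul_sub, mul_comm (Real.pi : ℂ) k]
    exact Complex.sin_antiperiodic.sub_nat_mul_eq k
  rw [this]
  rcases Nat.even_or_odd k with h | h <;> simp [h.neg_one_pow, div_neg]

/-- The binomial coefficients `b_n(s - k)` as Laplace integrals. -/
theorem bc_eq_laplace {s : ℂ} (hs : s.re < 1) (h : ∀ m : ℕ, s ≠ -(m : ℂ)) (k : ℕ) {n : ℕ}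
    (hn : k - s.re < n) :
    bc (s - k) n = (Complex.Gamma s * Complex.Gamma (1 - s))⁻¹ *
      ∫ h : ℝ in Ioi 0, ((Real.exp h - 1 : ℝ) : ℂ) ^ (-s) * (1 - Real.exp h : ℝ) ^ k *
        Complex.exp (-(n * h)) := by
  have hsk : (s - k).re < 1 := by
    have : (0 : ℝ) ≤ k := by positivity
    simp; linarith
  have h1 := laplace_exp_sub_one (n := n) hsk (by simp; linarith)
  have h2 : ∫ h : ℝ in Ioi 0, ((Real.exp h - 1 : ℝ) : ℂ) ^ (-s) * (1 - Real.exp h : ℝ) ^ k *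
      Complex.exp (-(n * h)) = (-1) ^ k * ∫ h : ℝ in Ioi 0,
        ((Real.exp h - 1 : ℝ) : ℂ) ^ (-(s - k)) * Complex.exp (-(n * h)) := by
    rw [← integral_const_mul]
    refine setIntegral_congr_fun measurableSet_Ioi fun h hh => ?_
    have hh : 0 < h := hh
    have hE : ((Real.exp h - 1 : ℝ) : ℂ) ≠ 0 := by
      exact_mod_cast (hh.trans_le (sub_exp_bounds h).1).ne'
    rw [neg_sub, sub_eq_add_neg (k : ℂ), Complex.cpow_add _ _ hE, Complex.cpow_natCast,
      show ((1 - Real.exp h : ℝ) : ℂ) = (-1) * ((Real.exp h - 1 : ℝ) : ℂ) by push_cast; ring, mul_pow]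
    ring
  have h3 := Complex.Gamma_ne_zero (ne_neg_natCast_sub hs h k)
  have h4 := Complex.Gamma_ne_zero h
  have h5 := Complex.Gamma_ne_zero_of_re_pos (s := 1 - s) (by simpa using hs)
  have h6 : (n.factorial : ℂ) ≠ 0 := by exact_mod_cast n.factorial_ne_zero
  have h7 := Gamma_reflect_sub s k
  have h8 : ((-1 : ℂ) ^ k) * (-1) ^ k = 1 := by rw [← mul_pow]; simp
  rw [h2, h1, bc_eq_Gamma (ne_neg_natCast_sub hs h k)]
  field_simp
  linear_combination (-(Complex.Gamma (n + (s - k)) * (-1) ^ k)) * h7 -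
    Complex.Gamma (n + (s - k)) * Complex.Gamma s * Complex.Gamma (1 - s) * h8

/-- `(n - θ)^(s - 1) / Γ(s)` as a Laplace integral. -/
theorem cpow_eq_laplace {s : ℂ} (hs : s.re < 1) (θ : ℝ) {n : ℕ} (hn : θ < n) :
    ((n - θ : ℝ) : ℂ) ^ (s - 1) / Complex.Gamma s = (Complex.Gamma s * Complex.Gamma (1 - s))⁻¹ *
      ∫ h : ℝ in Ioi 0, (h : ℂ) ^ (-s) * Complex.exp (θ * h) * Complex.exp (-(n * h)) := by
  have hr : 0 < n - θ := sub_pos.2 hn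
  have h1 := Complex.integral_cpow_mul_exp_neg_mul_Ioi (a := 1 - s) (by simpa using hs) hr
  have h5 := Complex.Gamma_ne_zero_of_re_pos (s := 1 - s) (by simpa using hs)
  have h2 : ∫ h : ℝ in Ioi 0, (h : ℂ) ^ (-s) * Complex.exp (θ * h) * Complex.exp (-(n * h)) =
      (1 / (n - θ : ℝ) : ℂ) ^ (1 - s) * Complex.Gamma (1 - s) := by
    rw [← h1]
    refine setIntegral_congr_fun measurableSet_Ioi fun h hh => ?_
    rw [mul_assoc, ← Complex.exp_add]
    push_cast
    ring_nf
  have h3 : (1 / (n - θ : ℝ) : ℂ) ^ (1 - s) = ((n - θ : ℝ) : ℂ) ^ (s - 1) := by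
    rw [one_div, Complex.inv_cpow, ← Complex.cpow_neg, neg_sub]
    rw [Complex.arg_ofReal_of_nonneg hr.le]
    exact Real.pi_pos.ne
  rw [h2, h3]
  rcases eq_or_ne (Complex.Gamma s) 0 with h | h
  · simp [h]
  · field_simp

/-- `(n - θ)^(s - 1) / Γ(s)` has the asymptotic expansion in the `b_n(s - k)` whose coefficients are
the Taylor coefficients of `shiftPow s θ`. -/
def HasBinExpansion (s : ℂ) (θ : ℝ) : Prop := ∀ K : ℕ,
  (fun n : ℕ => ∑ k ∈ Finset.range K, tc (shiftPow s θ) k * bc (s - k) n -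
    ((n - θ : ℝ) : ℂ) ^ (s - 1) / Complex.Gamma s) =O[atTop] fun n : ℕ => (n : ℝ) ^ (s.re - 1 - K)

/-- The formula for `shiftPow` at -h. It says that the Laplace integrand of (n-θ)^(s-1) is that of
`bc s n` times `shiftPow s θ` at u = 1 - e^h. -/
theorem shiftPow_one_sub_exp_pos {h : ℝ} (hh : 0 < h) (s θ : ℂ) :
    ((Real.exp h - 1 : ℝ) : ℂ) ^ (-s) * shiftPow s θ ((1 - Real.exp h : ℝ) : ℂ) =
      (h : ℂ) ^ (-s) * Complex.exp (θ * h) := by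
  have hE : 0 < Real.exp h - 1 := hh.trans_le (sub_exp_bounds h).1
  have h1 := shiftPow_one_sub_exp (neg_ne_zero.2 hh.ne') s θ
  rw [neg_neg] at h1
  rw [h1, show -h / (1 - Real.exp h) = h / (Real.exp h - 1) by rw [← neg_div_neg_eq]; ring_nf,
    Real.log_div hh.ne' hE.ne', Complex.cpow_def_of_ne_zero (by exact_mod_cast hE.ne'),
    Complex.cpow_def_of_ne_zero (by exact_mod_cast hh.ne'), ← Complex.ofReal_log hE.le,
    ← Complex.ofReal_log hh.le, ← Complex.exp_add, ← Complex.exp_add]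
  push_cast
  ring_nf

theorem norm_cpow_exp_sub_one {h : ℝ} (hh : 0 < h) (s : ℂ) :
    ‖((Real.exp h - 1 : ℝ) : ℂ) ^ (-s)‖ ≤ h ^ (-s.re) * Real.exp (|s.re| * h) := by
  rw [Complex.norm_cpow_eq_rpow_re_of_pos (hh.trans_le (sub_exp_bounds h).1), Complex.neg_re]
  simpa using rpow_exp_sub_one_le (-s.re) hh

theorem norm_one_sub_exp_pow_le {h : ℝ} (hh : 0 < h) (k : ℕ) :
    ‖((1 - Real.exp h : ℝ) : ℂ) ^ k‖ ≤ h ^ k * Real.exp (k * h) := by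
  obtain ⟨h1, h2⟩ := sub_exp_bounds h
  rw [norm_pow, Complex.norm_real, Real.norm_eq_abs, abs_sub_comm, abs_of_nonneg (by linarith),
    Real.exp_nat_mul, ← mul_pow]
  exact pow_le_pow_left₀ (by linarith) h2 k

theorem norm_one_sub_exp_pow_le' {h : ℝ} (hh : 0 < h) (k : ℕ) :
    ‖((1 - Real.exp h : ℝ) : ℂ) ^ k‖ ≤ Real.exp (k * h) := by
  obtain ⟨h1, h2⟩ := sub_exp_bounds h
  rw [norm_pow, Complex.norm_real, Real.norm_eq_abs, abs_sub_comm, abs_of_nonneg (by linarith),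
    Real.exp_nat_mul]
  exact pow_le_pow_left₀ (by linarith) (by linarith) k

/-- A global bound for the remainder of the Taylor expansion of `shiftPow` along `u = 1 - e^h`. -/
theorem shiftPow_remainder (s : ℂ) (θ : ℝ) (K : ℕ) : ∃ C A : ℝ, 0 ≤ C ∧ ∀ h : ℝ, 0 < h →
    ‖shiftPow s θ ((1 - Real.exp h : ℝ) : ℂ) -
      ∑ k ∈ Finset.range K, tc (shiftPow s θ) k * ((1 - Real.exp h : ℝ) : ℂ) ^ k‖ ≤
    C * h ^ K * Real.exp (A * h) := by
  obtain ⟨C₀, hC₀, h0⟩ := (sub_sum_tc_isBigO (analyticAt_shiftPow s θ) K).exists_nonneg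
  rw [isBigOWith_iff] at h0
  have ht : Tendsto (fun h : ℝ => ((1 - Real.exp h : ℝ) : ℂ)) (𝓝 0) (𝓝 0) := by
    have : Continuous fun h : ℝ => ((1 - Real.exp h : ℝ) : ℂ) := by fun_prop
    simpa using this.tendsto 0
  obtain ⟨δ, hδ, h1⟩ := Metric.eventually_nhds_iff.1 (ht.eventually h0)
  set D := ∑ k ∈ Finset.range K, ‖tc (shiftPow s θ) k‖ with hD
  have hD0 : 0 ≤ D := Finset.sum_nonneg fun _ _ => norm_nonneg _
  refine ⟨C₀ + (1 + D) / δ ^ K, K + |s.re| + |θ|, by positivity, fun h hh => ?_⟩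
  rw [add_mul, add_mul]
  have hab : (0 : ℝ) ≤ |s.re| + |θ| := by positivity
  -- Near 0 the Taylor estimate applies. For h ≥ δ the function and the Taylor polynomial are
  -- bounded separately by exponentials, and (h/δ)^K ≥ 1 supplies the factor h^K.
  by_cases hd : h < δ
  · have h2 := h1 (y := h) (by simpa [abs_of_pos hh] using hd)
    have h3 := norm_one_sub_exp_pow_le hh K
    have h4 : Real.exp (K * h) ≤ Real.exp ((K + |s.re| + |θ|) * h) := by
      apply Real.exp_le_exp.2
      nlinarith
    rw [norm_pow, norm_norm, ← norm_pow] at h2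
    have h5 : 0 ≤ (1 + D) / δ ^ K * h ^ K * Real.exp ((K + |s.re| + |θ|) * h) := by positivity
    have h6 : C₀ * (h ^ K * Real.exp (K * h)) ≤ C₀ * h ^ K * Real.exp ((K + |s.re| + |θ|) * h) := by
      rw [mul_assoc]; gcongr
    have h7 := mul_le_mul_of_nonneg_left h3 hC₀
    linarith
  · push Not at hd
    obtain ⟨b1, b2⟩ := sub_exp_bounds h
    have hE : 0 < Real.exp h - 1 := by linarith
    have h2 : ‖shiftPow s θ ((1 - Real.exp h : ℝ) : ℂ)‖ ≤ Real.exp ((K + |s.re| + |θ|) * h) := by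
      have e := congrArg norm (shiftPow_one_sub_exp_pos hh s θ)
      rw [norm_mul, norm_mul, Complex.norm_cpow_eq_rpow_re_of_pos hE,
        Complex.norm_cpow_eq_rpow_re_of_pos hh, Complex.norm_exp] at e
      have e2 : ((θ : ℂ) * h).re = θ * h := by simp
      rw [e2, Complex.neg_re] at e
      have p1 : (Real.exp h - 1) ^ (-s.re) * (Real.exp h - 1) ^ s.re = 1 := by
        rw [← Real.rpow_add hE]; simp
      have p2 : h ^ (-s.re) * h ^ s.re = 1 := by
        rw [← Real.rpow_add hh]; simp
      have p3 := rpow_exp_sub_one_le s.re hh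
      calc _ = (Real.exp h - 1) ^ s.re * ((Real.exp h - 1) ^ (-s.re) *
            ‖shiftPow s θ ((1 - Real.exp h : ℝ) : ℂ)‖) := by
            rw [← mul_assoc, mul_comm ((Real.exp h - 1) ^ s.re), p1, one_mul]
        _ = (Real.exp h - 1) ^ s.re * (h ^ (-s.re) * Real.exp (θ * h)) := by rw [e]
        _ ≤ h ^ s.re * Real.exp (|s.re| * h) * (h ^ (-s.re) * Real.exp (θ * h)) := by gcongr
        _ = (h ^ (-s.re) * h ^ s.re) * (Real.exp (|s.re| * h) * Real.exp (θ * h)) := by ring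
        _ = Real.exp (|s.re| * h + θ * h) := by rw [p2, one_mul, Real.exp_add]
        _ ≤ _ := by
          apply Real.exp_le_exp.2
          have := le_abs_self θ
          have hK : (0 : ℝ) ≤ K := by positivity
          nlinarith [mul_le_mul_of_nonneg_right this hh.le, mul_nonneg hK hh.le]
    have h3 : ‖∑ k ∈ Finset.range K, tc (shiftPow s θ) k * ((1 - Real.exp h : ℝ) : ℂ) ^ k‖ ≤
        D * Real.exp ((K + |s.re| + |θ|) * h) := by
      refine (norm_sum_le _ _).trans ?_
      rw [hD, Finset.sum_mul]
      refine Finset.sum_le_sum fun k hk => ?_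
      rw [norm_mul]
      have hk' : (k : ℝ) ≤ K := by exact_mod_cast (Finset.mem_range.1 hk).le
      have := norm_one_sub_exp_pow_le' hh k
      gcongr
      refine this.trans (Real.exp_le_exp.2 ?_)
      nlinarith
    have h4 : 1 ≤ h ^ K / δ ^ K := by
      rw [one_le_div (by positivity)]
      exact pow_le_pow_left₀ hδ.le hd K
    have h5 : 0 ≤ C₀ * h ^ K * Real.exp ((K + |s.re| + |θ|) * h) := by positivity
    have h6 : (1 + D) * Real.exp ((K + |s.re| + |θ|) * h) ≤
        (1 + D) / δ ^ K * h ^ K * Real.exp ((K + |s.re| + |θ|) * h) := by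
      rw [div_mul_eq_mul_div, mul_div_assoc]
      gcongr
      exact le_mul_of_one_le_right (by positivity) h4
    refine (norm_sub_le _ _).trans ?_
    linarith

theorem sub_rpow_isBigO (A b : ℝ) :
    (fun n : ℕ => ((n : ℝ) - A) ^ b) =O[atTop] fun n : ℕ => (n : ℝ) ^ b := by
  have h : Tendsto (fun n : ℕ => (1 - A / n) ^ b) atTop (𝓝 ((1 - 0) ^ b)) := by
    refine Tendsto.rpow_const ?_ (Or.inl (by norm_num))
    exact tendsto_const_nhds.sub (tendsto_const_div_atTop_nhds_zero_nat A)
  have h1 := (h.isBigO_one ℝ).mul (isBigO_refl (fun n : ℕ => (n : ℝ) ^ b) atTop)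
  simp only [one_mul] at h1
  refine h1.congr' ?_ EventuallyEq.rfl
  filter_upwards [eventually_gt_atTop 0, tendsto_natCast_atTop_atTop.eventually_gt_atTop A]
    with n hn hA
  have hn' : (0 : ℝ) < n := by exact_mod_cast hn
  rw [← Real.mul_rpow _ hn'.le]
  · congr 1
    field_simp
  · rw [sub_nonneg, div_le_one hn']
    exact hA.le

/-- Both sides vanish for large n: the series (1 - X)^(m+k) are polynomials, and with `Gamma = 0` at
the poles and division by 0 equal to 0, the quotient agrees with 1/Γ = 0. -/
theorem hasBinExpansion_neg_natCast (m : ℕ) (θ : ℝ) : HasBinExpansion (-(m : ℂ)) θ := by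
  intro K
  refine IsBigO.of_bound 0 ?_
  filter_upwards [eventually_gt_atTop (m + K)] with n hn
  rw [Complex.Gamma_neg_nat_eq_zero, div_zero, sub_zero, Finset.sum_eq_zero]
  · simp
  · intro k hk
    have hk' := Finset.mem_range.1 hk
    have : -(m : ℂ) - k = -((m + k : ℕ) : ℂ) := by push_cast; ring
    rw [this, bc_neg_natCast (by lia), mul_zero]

/-- Watson's lemma: under the Laplace integral the difference of the two sides is the Taylor
remainder of `shiftPow s θ`, of order h^K, times (e^h - 1)^(-s). The condition on Re s makes the
integrals converge at 0. -/
theorem hasBinExpansion_of_re_lt_one {s : ℂ} (hs : s.re < 1) (θ : ℝ) : HasBinExpansion s θ := by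
  by_cases h : ∀ m : ℕ, s ≠ -(m : ℂ)
  swap
  · push Not at h
    obtain ⟨m, rfl⟩ := h
    exact hasBinExpansion_neg_natCast m θ
  intro K
  obtain ⟨C, A, hC, hrem⟩ := shiftPow_remainder s θ K
  set S := (Complex.Gamma s * Complex.Gamma (1 - s))⁻¹ with hS
  let P : ℝ → ℂ := fun h => ((Real.exp h - 1 : ℝ) : ℂ) ^ (-s)
  let u : ℝ → ℂ := fun h => ((1 - Real.exp h : ℝ) : ℂ)
  have hPc : ContinuousOn P (Ioi 0) := by
    intro h hh
    have hE : 0 < Real.exp h - 1 := (show 0 < h from hh).trans_le (sub_exp_bounds h).1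
    refine ContinuousAt.continuousWithinAt ?_
    refine ContinuousAt.cpow (by fun_prop) continuousAt_const ?_
    exact Or.inl (by rw [Complex.ofReal_re]; exact hE)
  have huc : ContinuousOn u (Ioi 0) := by fun_prop
  have hGc : ContinuousOn (fun h : ℝ => (h : ℂ) ^ (-s) * Complex.exp (θ * h)) (Ioi 0) := by
    refine ContinuousOn.mul ?_ (by fun_prop)
    intro h hh
    refine ContinuousAt.continuousWithinAt ?_
    refine ContinuousAt.cpow (by fun_prop) continuousAt_const (Or.inl (by simpa using hh))
  have b1 : ∀ k : ℕ, ∀ᶠ n : ℕ in atTop,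
      IntegrableOn (fun h : ℝ => P h * u h ^ k * Complex.exp (-(n * h))) (Ioi 0) := by
    intro k
    refine (eventually_laplace_bound (C := 1) (a := -s.re) (A := |s.re| + k) (by linarith)
      (g := fun h => P h * u h ^ k) (hPc.mul (huc.pow k)) fun h hh => ?_).mono fun n hn => hn.1
    rw [norm_mul]
    calc _ ≤ h ^ (-s.re) * Real.exp (|s.re| * h) * Real.exp (k * h) := by
          have h1 := norm_cpow_exp_sub_one hh s
          have h2 := norm_one_sub_exp_pow_le' hh k
          exact mul_le_mul h1 h2 (norm_nonneg _) (by positivity)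
      _ = _ := by rw [mul_assoc, ← Real.exp_add]; ring_nf
  have b2 : ∀ᶠ n : ℕ in atTop, IntegrableOn (fun h : ℝ =>
      (h : ℂ) ^ (-s) * Complex.exp (θ * h) * Complex.exp (-(n * h))) (Ioi 0) := by
    refine (eventually_laplace_bound (C := 1) (a := -s.re) (A := θ) (by linarith)
      hGc fun h hh => ?_).mono fun n hn => hn.1
    rw [norm_mul, Complex.norm_cpow_eq_rpow_re_of_pos hh, Complex.norm_exp]
    simp
  have b3 := eventually_laplace_bound (C := C) (a := K - s.re) (A := |s.re| + A)
    (g := fun h : ℝ => ∑ k ∈ Finset.range K, tc (shiftPow s θ) k * (P h * u h ^ k) -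
      (h : ℂ) ^ (-s) * Complex.exp (θ * h))
    (by have : (0 : ℝ) ≤ K := by positivity
        linarith)
    ((continuousOn_finsetSum _ fun k _ => (hPc.mul (huc.pow k)).const_mul _).sub hGc)
    (fun h hh => by
      have e : ∑ k ∈ Finset.range K, tc (shiftPow s θ) k * (P h * u h ^ k) -
          (h : ℂ) ^ (-s) * Complex.exp (θ * h) =
          -(P h * (shiftPow s θ (u h) - ∑ k ∈ Finset.range K, tc (shiftPow s θ) k * u h ^ k)) := by
        rw [← shiftPow_one_sub_exp_pos hh, mul_sub, neg_sub, Finset.mul_sum]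
        congr 1
        exact Finset.sum_congr rfl fun k _ => by ring
      rw [e, norm_neg, norm_mul]
      calc _ ≤ (h ^ (-s.re) * Real.exp (|s.re| * h)) * (C * h ^ K * Real.exp (A * h)) :=
            mul_le_mul (norm_cpow_exp_sub_one hh s) (hrem h hh) (norm_nonneg _) (by positivity)
        _ = C * (h ^ (-s.re) * h ^ (K : ℝ)) * (Real.exp (|s.re| * h) * Real.exp (A * h)) := by
            rw [Real.rpow_natCast]; ring
        _ = _ := by
            rw [← Real.rpow_add hh, ← Real.exp_add]
            ring_nf)
  have hO : (fun n : ℕ => (1 / ((n : ℝ) - (|s.re| + A))) ^ (K - s.re + 1)) =O[atTop]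
      fun n : ℕ => (n : ℝ) ^ (s.re - 1 - K) := by
    refine (sub_rpow_isBigO (|s.re| + A) (s.re - 1 - K)).congr' ?_ EventuallyEq.rfl
    filter_upwards [tendsto_natCast_atTop_atTop.eventually_gt_atTop (|s.re| + A)] with n hn
    rw [one_div, Real.inv_rpow (by linarith), ← Real.rpow_neg (by linarith)]
    ring_nf
  refine IsBigO.trans (IsBigO.of_bound (‖S‖ * (C * Real.Gamma (K - s.re + 1))) ?_) hO
  have b1' : ∀ᶠ n : ℕ in atTop, ∀ k ∈ Finset.range K,
      IntegrableOn (fun h : ℝ => P h * u h ^ k * Complex.exp (-(n * h))) (Ioi 0) :=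
    (Finset.range K).eventually_all.2 fun k _ => b1 k
  filter_upwards [b1', b2, b3, tendsto_natCast_atTop_atTop.eventually_gt_atTop θ,
    tendsto_natCast_atTop_atTop.eventually_gt_atTop (K - s.re),
    tendsto_natCast_atTop_atTop.eventually_gt_atTop (|s.re| + A)] with n h1 h2 h3 h4 h5 h6
  have e : ∑ k ∈ Finset.range K, tc (shiftPow s θ) k * bc (s - k) n -
      ((n - θ : ℝ) : ℂ) ^ (s - 1) / Complex.Gamma s =
      S * ∫ h : ℝ in Ioi 0, (∑ k ∈ Finset.range K, tc (shiftPow s θ) k * (P h * u h ^ k) -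
        (h : ℂ) ^ (-s) * Complex.exp (θ * h)) * Complex.exp (-(n * h)) := by
    simp only [sub_mul, Finset.sum_mul, mul_assoc (tc _ _)]
    rw [integral_sub (integrable_finsetSum _ fun k hk => (h1 k hk).const_mul _) h2,
      integral_finsetSum _ fun k hk => (h1 k hk).const_mul _, cpow_eq_laplace hs θ h4, mul_sub,
      Finset.mul_sum]
    congr 1
    refine Finset.sum_congr rfl fun k hk => ?_
    have hk' : (k : ℝ) < K := by exact_mod_cast Finset.mem_range.1 hk
    rw [integral_const_mul, bc_eq_laplace hs h k (by linarith)]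
    ring
  rw [e, norm_mul, Real.norm_of_nonneg (Real.rpow_nonneg (one_div_nonneg.2 (by linarith)) _)]
  calc _ ≤ ‖S‖ * (C * ((1 / (n - (|s.re| + A))) ^ (K - s.re + 1) * Real.Gamma (K - s.re + 1))) := by
        gcongr
        exact h3.2
    _ = _ := by ring

end

/-! ### The binomial expansion for all s, and the samples of the power function -/

section

/-- The recursions `tc_shiftPow_succ` and `natCast_mul_bc` match term by term, so the sums telescope
and leave one boundary term, no larger than the admitted error. -/
theorem sum_tc_mul_bc_succ (s θ : ℂ) (K n : ℕ) :
    s * ∑ k ∈ Finset.range (K + 1), tc (shiftPow (s + 1) θ) k * bc (s + 1 - k) n =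
      (n - θ) * ∑ k ∈ Finset.range (K + 1), tc (shiftPow s θ) k * bc (s - k) n +
        (s - K + θ) * tc (shiftPow s θ) K * bc (s - K) n := by
  induction K with
  | zero =>
    have := natCast_mul_bc s n
    simp only [zero_add, Finset.range_one, Finset.sum_singleton, Nat.cast_zero, sub_zero,
      tc_shiftPow_zero]
    linear_combination (-1 : ℂ) * this
  | succ K ih =>
    rw [Finset.sum_range_succ, mul_add, ih, Finset.sum_range_succ _ (K + 1), mul_add]
    have h1 := tc_shiftPow_succ s θ K
    have h2 := natCast_mul_bc (s - (K + 1 : ℕ)) n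
    have e1 : s + 1 - ((K + 1 : ℕ) : ℂ) = s - K := by push_cast; ring
    have e2 : s - ((K + 1 : ℕ) : ℂ) + 1 = s - K := by push_cast; ring
    rw [e2] at h2
    rw [e1]
    push_cast at h2 ⊢
    linear_combination bc (s - K) n * h1 - tc (shiftPow s θ) (K + 1) * h2

theorem HasBinExpansion.add_one {s : ℂ} {θ : ℝ} (h : HasBinExpansion s θ) (hs : s ≠ 0) :
    HasBinExpansion (s + 1) θ := by
  intro K
  have hn1 : (fun n : ℕ => ((n - θ : ℝ) : ℂ)) =O[atTop] fun n : ℕ => (n : ℝ) ^ (1 : ℝ) := by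
    refine IsBigO.trans ?_ (sub_rpow_isBigO θ 1)
    refine IsBigO.of_bound 1 (Eventually.of_forall fun n => ?_)
    rw [Complex.norm_real, Real.rpow_one, one_mul]
  have e3 : ∀ n : ℕ, θ < n → ((n - θ : ℝ) : ℂ) * (((n - θ : ℝ) : ℂ) ^ (s - 1) / Complex.Gamma s) =
      s * (((n - θ : ℝ) : ℂ) ^ (s + 1 - 1) / Complex.Gamma (s + 1)) := by
    intro n hn
    have h0 : ((n - θ : ℝ) : ℂ) ≠ 0 := by exact_mod_cast (sub_pos.2 hn).ne'
    rw [Complex.Gamma_add_one _ hs, add_sub_cancel_right, Complex.cpow_sub _ _ h0, Complex.cpow_one]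
    rcases eq_or_ne (Complex.Gamma s) 0 with hg | hg
    · simp [hg]
    · field_simp
  have hmul : ∀ a : ℝ, (fun n : ℕ => (n : ℝ) ^ (1 : ℝ) * (n : ℝ) ^ a) =ᶠ[atTop]
      fun n : ℕ => (n : ℝ) ^ (1 + a) := fun a => by
    filter_upwards [eventually_gt_atTop 0] with n hn
    rw [← Real.rpow_add (by exact_mod_cast hn)]
  cases K with
  | zero =>
    have h1 := (hn1.mul (h 0)).trans_eventuallyEq (hmul _)
    refine (h1.const_mul_left s⁻¹).congr' ?_ ?_
    · filter_upwards [tendsto_natCast_atTop_atTop.eventually_gt_atTop θ] with n hn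
      have := e3 n hn
      simp only [Finset.range_zero, Finset.sum_empty, zero_sub, mul_neg]
      rw [this, inv_mul_cancel_left₀ hs]
    · refine Eventually.of_forall fun n => ?_
      simp only [Complex.add_re, Complex.one_re, Nat.cast_zero]
      ring_nf
  | succ K =>
    have h1 := (hn1.mul (h (K + 1))).trans_eventuallyEq (hmul _)
    have h2 := (bc_isBigO (s - K)).const_mul_left ((s - K + θ) * tc (shiftPow s θ) K)
    have h3 : (fun n : ℕ => (n : ℝ) ^ (1 + (s.re - 1 - (K + 1 : ℕ)))) =
        fun n : ℕ => (n : ℝ) ^ ((s + 1).re - 1 - (K + 1 : ℕ)) := by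
      funext n
      simp only [Complex.add_re, Complex.one_re]
      ring_nf
    have h4 : (fun n : ℕ => (n : ℝ) ^ ((s - K).re - 1)) =
        fun n : ℕ => (n : ℝ) ^ ((s + 1).re - 1 - (K + 1 : ℕ)) := by
      funext n
      simp only [Complex.add_re, Complex.one_re, Complex.sub_re, Complex.natCast_re]
      push_cast
      ring_nf
    rw [h3] at h1
    rw [h4] at h2
    refine ((h1.add h2).const_mul_left s⁻¹).congr' ?_ EventuallyEq.rfl
    filter_upwards [tendsto_natCast_atTop_atTop.eventually_gt_atTop θ] with n hn
    have a1 := e3 n hn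
    have a2 := sum_tc_mul_bc_succ s θ K n
    rw [inv_mul_eq_iff_eq_mul₀ hs, mul_sub, a1, mul_sub, a2]
    push_cast
    ring

/-- The case that the recursion cannot reach, since it would divide by s = 0. Here the k = 0 term is
already exact, and the later ones are coefficients of polynomials. -/
theorem hasBinExpansion_one (θ : ℝ) : HasBinExpansion 1 θ := by
  intro K
  have hz : ∀ n : ℕ, ((n - θ : ℝ) : ℂ) ^ ((1 : ℂ) - 1) / Complex.Gamma 1 = 1 := by simp
  cases K with
  | zero =>
    refine IsBigO.of_bound 1 (Eventually.of_forall fun n => ?_)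
    rw [hz]
    simp
  | succ K =>
    refine IsBigO.of_bound 0 ?_
    filter_upwards [eventually_gt_atTop K] with n hn
    rw [hz, Finset.sum_range_succ', Finset.sum_eq_zero]
    · simp [tc_shiftPow_zero, bc_one_left]
    · intro k hk
      have hk' := Finset.mem_range.1 hk
      have : (1 : ℂ) - ((k + 1 : ℕ) : ℂ) = -(k : ℂ) := by push_cast; ring
      rw [this, bc_neg_natCast (by lia), mul_zero]

theorem hasBinExpansion (s : ℂ) (θ : ℝ) : HasBinExpansion s θ := by
  have key : ∀ (m : ℕ) (s : ℂ), s.re < m + 1 → HasBinExpansion s θ := by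
    intro m
    induction m with
    | zero => exact fun s hs => hasBinExpansion_of_re_lt_one (by simpa using hs) θ
    | succ m ih =>
      intro s hs
      rcases eq_or_ne s 1 with rfl | h1
      · exact hasBinExpansion_one θ
      · have := (ih (s - 1) (by push_cast at hs; simp; linarith)).add_one (sub_ne_zero.2 h1)
        rwa [sub_add_cancel] at this
  obtain ⟨m, hm⟩ := exists_nat_gt s.re
  exact key m s (by linarith)

open PowerSeries

/-- The series of the samples of the power function is a binomial series times a polynomial, up to
rapidly decaying coefficients. -/
theorem mk_powFun_eq {β : ℂ} (hβ : ∀ m : ℕ, β ≠ -(m : ℂ)) (M : ℝ) : ∃ (K₀ : ℕ), ∀ K ≥ K₀,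
    ∃ R : ℂ⟦X⟧, Bd R (-M) ∧ (mk fun n : ℕ => powFun β n) =
      C (Complex.Gamma β) * (negBin 1 β *
        ∑ k ∈ Finset.range K, C (tc (shiftPow β 0) k) * (1 - X) ^ k) + R := by
  -- `R` is defined as the difference. The expansion controls it for large n, and finitely many
  -- coefficients, such as the one from the conventional value at t = 0, do not affect `Bd`.
  obtain ⟨K₀, hK₀⟩ := exists_nat_ge (β.re - 1 + M)
  refine ⟨K₀, fun K hK => ⟨_, ?_, (add_sub_cancel _ _).symm⟩⟩
  have hK' : (K₀ : ℝ) ≤ K := by exact_mod_cast hK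
  have h1 := (hasBinExpansion β 0 K).const_mul_left (-Complex.Gamma β)
  have hg := Complex.Gamma_ne_zero hβ
  refine Bd.mono (Bd_of_isBigO (a := β.re - 1 - K) (h1.congr' (Eventually.of_forall fun n => ?_)
    EventuallyEq.rfl)) (by linarith)
  have e : ∀ k : ℕ, negBin 1 β * (C (tc (shiftPow β 0) k) * (1 - X) ^ k) =
      C (tc (shiftPow β 0) k) * negBin 1 (β - k) := by
    intro k
    rw [sub_eq_add_neg β, negBin_add, negBin_one_neg_natCast]
    ring
  rw [Finset.mul_sum]
  simp only [e]
  rw [map_sub, coeff_mk, coeff_C_mul, map_sum]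
  simp only [coeff_C_mul]
  rw [powFun, mul_sub, neg_mul, neg_mul]
  simp only [Complex.ofReal_zero, sub_zero, Complex.ofReal_natCast]
  field_simp
  simp only [bc]
  ring

end

/-! ### Separation of the singularities by a partition of unity -/

section

open PowerSeries

/-- The coefficients of `F` decay faster than any power. -/
def Fast (F : ℂ⟦X⟧) : Prop := ∀ M : ℝ, Bd F (-M)

theorem Bd.mul_neg {F G : ℂ⟦X⟧} {M : ℝ} (hM : 0 ≤ M) (hF : Bd F (-M)) (hG : Bd G (-(M + 2))) :
    Bd (F * G) (-M) :=
  hF.mul hG (by rw [abs_neg, abs_of_nonneg hM])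

theorem Fast.mul {F G : ℂ⟦X⟧} (hF : Fast F) (hG : Fast G) : Fast (F * G) := fun M =>
  (Bd.mul_neg (abs_nonneg M) (hF |M|) (hG _)).mono (neg_le_neg (le_abs_self M))

theorem fast_polynomial (P : Polynomial ℂ) : Fast (P : ℂ⟦X⟧) := fun M => by
  apply Bd_of_isBigO
  refine IsBigO.of_bound 0 ?_
  filter_upwards [eventually_gt_atTop P.natDegree] with n hn
  rw [Polynomial.coeff_coe, P.coeff_eq_zero_of_natDegree_lt hn]
  simp

theorem rpow_isBigO_geometric (M : ℝ) {r : ℝ} (hr : 1 < r) :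
    (fun n : ℕ => (r ^ n)⁻¹) =O[atTop] fun n : ℕ => (n : ℝ) ^ (-M) := by
  have h := (isLittleO_pow_exp_pos_mul_atTop ⌈|M|⌉₊ (Real.log_pos hr)).isBigO.comp_tendsto
    tendsto_natCast_atTop_atTop
  have h2 := h.inv_rev (by
    filter_upwards [eventually_gt_atTop 0] with n hn h0
    have : (n : ℝ) ≠ 0 := by exact_mod_cast hn.ne'
    simp [this] at h0)
  refine IsBigO.trans (IsBigO.of_bound 1 (Eventually.of_forall fun n => ?_)) (h2.trans ?_)
  · simp only [Function.comp]
    rw [mul_comm (Real.log r), Real.exp_nat_mul, Real.exp_log (by linarith), one_mul]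
  · refine IsBigO.of_bound 1 ?_
    filter_upwards [eventually_ge_atTop 1] with n hn
    have hn' : (1 : ℝ) ≤ n := by exact_mod_cast hn
    simp only [Function.comp]
    rw [one_mul, Real.norm_of_nonneg (by positivity), Real.norm_of_nonneg (by positivity),
      ← Real.rpow_natCast, ← Real.rpow_neg (by positivity)]
    apply Real.rpow_le_rpow_of_exponent_le hn'
    have := Nat.le_ceil |M|
    have := le_abs_self M
    linarith

/-- The Taylor series of a function analytic on the closed unit disc. -/
theorem exists_fast_rep {ν : ℂ → ℂ} (hν : AnalyticOnNhd ℂ ν (Metric.closedBall 0 1)) :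
    ∃ N : ℂ⟦X⟧, Fast N ∧ Rep N ν := by
  have hU : IsOpen {z | AnalyticAt ℂ ν z} := isOpen_analyticAt ℂ ν
  -- By compactness ν is analytic on a disc of radius 1 + δ, so its coefficients decay
  -- geometrically.
  obtain ⟨δ, hδ, hsub⟩ := (isCompact_closedBall (0 : ℂ) 1).exists_cthickening_subset_open hU hν
  have hsub' : ∀ z ∈ Metric.closedBall (0 : ℂ) (1 + δ), AnalyticAt ℂ ν z := by
    rw [cthickening_closedBall hδ.le zero_le_one, add_comm] at hsub
    exact hsub
  let r : NNReal := ⟨1 + δ, by linarith⟩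
  have hr : (1 : ℝ) < r := by
    change (1 : ℝ) < 1 + δ
    linarith
  have hd : DifferentiableOn ℂ ν (Metric.closedBall 0 r) := fun z hz =>
    (hsub' z hz).differentiableAt.differentiableWithinAt
  have hp := hd.hasFPowerSeriesOnBall (by exact_mod_cast (zero_lt_one.trans hr))
  set p := cauchyPowerSeries ν 0 r
  refine ⟨mk fun n => p.coeff n, fun M => ?_, fun ξ hξ => ?_⟩
  · obtain ⟨r', hr1, hr2⟩ := exists_between hr
    lift r' to NNReal using by linarith
    obtain ⟨C, hC, hb⟩ := p.norm_mul_pow_le_of_lt_radius (r := r')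
      (lt_of_lt_of_le (by exact_mod_cast hr2) hp.r_le)
    apply Bd_of_isBigO
    refine IsBigO.trans (IsBigO.of_bound C (Eventually.of_forall fun n => ?_))
      (rpow_isBigO_geometric M hr1)
    have hpos : (0 : ℝ) < (r' : ℝ) ^ n := by positivity
    rw [coeff_mk, Real.norm_of_nonneg (by positivity), ← div_eq_mul_inv, le_div_iff₀ hpos,
      ← p.norm_apply_eq_norm_coef]
    exact hb n
  · have h := hp.hasSum (y := ξ) (by
      rw [Metric.mem_eball, edist_zero_right, enorm_eq_nnnorm]
      have : ‖ξ‖₊ < r := hξ.trans hr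
      exact_mod_cast this)
    rw [zero_add] at h
    convert! h using 1
    funext n
    rw [coeff_mk, FormalMultilinearSeries.apply_eq_pow_smul_coeff, smul_eq_mul, mul_comm]

variable {ι : Type*}

theorem exists_decay_prod (s : Finset ι) {z a : ι → ℂ} (hz : ∀ i, ‖z i‖ = 1) (M : ℝ) :
    ∃ K₀ : ℕ, ∀ K ≥ K₀, Bd (∏ i ∈ s, negBin (z i) (a i - (K : ℕ))) (-M) := by
  classical
  wlog hM : 0 ≤ M generalizing M
  · obtain ⟨K₀, h⟩ := this 0 le_rfl
    exact ⟨K₀, fun K hK => (h K hK).mono (by push Not at hM; linarith)⟩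
  induction s using Finset.induction_on generalizing M with
  | empty => exact ⟨0, fun K _ => by simpa using fast_polynomial 1 M⟩
  | insert i s hi ih =>
    obtain ⟨K₁, h1⟩ := ih (M + 2) (by linarith)
    obtain ⟨K₂, h2⟩ := exists_nat_ge ((a i).re - 1 + M)
    refine ⟨max K₁ K₂, fun K hK => ?_⟩
    rw [Finset.prod_insert hi]
    refine Bd.mul_neg hM ((Bd_negBin (hz i) _).mono ?_) (h1 K (le_of_max_le_left hK))
    have : (K₂ : ℝ) ≤ K := by exact_mod_cast le_of_max_le_right hK
    simp
    linarith

/-- The factor `1 - z X`, as a polynomial. -/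
noncomputable def lin (z : ℂ) : Polynomial ℂ := 1 - Polynomial.C z * Polynomial.X

theorem coe_lin_pow (z : ℂ) (K : ℕ) : ((lin z ^ K : Polynomial ℂ) : ℂ⟦X⟧) = negBin z (-(K : ℂ)) := by
  rw [negBin_neg_natCast, lin]
  simp

theorem isCoprime_lin {z w : ℂ} (h : z ≠ w) : IsCoprime (lin z) (lin w) := by
  refine ⟨Polynomial.C (-w / (z - w)), Polynomial.C (z / (z - w)), ?_⟩
  have h' : z - w ≠ 0 := sub_ne_zero.2 h
  have e : (Polynomial.C (-w / (z - w)) + Polynomial.C (z / (z - w)) : Polynomial ℂ) = 1 := by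
    rw [← Polynomial.C_add, ← Polynomial.C_1]
    congr 1
    field_simp
    ring
  have e2 : (Polynomial.C (-w / (z - w)) * Polynomial.C z + Polynomial.C (z / (z - w)) *
      Polynomial.C w : Polynomial ℂ) = 0 := by
    rw [← Polynomial.C_mul, ← Polynomial.C_mul, ← Polynomial.C_add, ← Polynomial.C_0]
    congr 1
    field_simp
    ring
  rw [lin, lin]
  linear_combination e - Polynomial.X * e2

/-- Powers of distinct linear factors are pairwise coprime. The summands form a partition of unity:
the j-th contains the K-th power of every factor but its own. -/
theorem exists_bezout [Fintype ι] [Nonempty ι] [DecidableEq ι] {z : ι → ℂ}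
    (hz : Function.Injective z) (K : ℕ) :
    ∃ μ : ι → Polynomial ℂ, ∑ j, μ j * ∏ i ∈ {j}ᶜ, lin (z i) ^ K = 1 :=
  exists_sum_eq_one_iff_pairwise_coprime'.2 fun _ _ hij =>
    (isCoprime_lin fun h => hij (hz h)).pow

variable [Fintype ι] [DecidableEq ι] {z a : ι → ℂ}

/-- Multiplication by the `j`-th element of the partition of unity removes the singularities other
than the `j`-th. -/
theorem partition_mul_prod (j : ι) (z a : ι → ℂ) (K : ℕ) :
    ((∏ i ∈ {j}ᶜ, lin (z i) ^ K : Polynomial ℂ) : ℂ⟦X⟧) * ∏ i, negBin (z i) (a i) =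
      negBin (z j) (a j) * ∏ i ∈ {j}ᶜ, negBin (z i) (a i - K) := by
  rw [Fintype.prod_eq_mul_prod_compl j, mul_left_comm]
  congr 1
  rw [← Polynomial.coeToPowerSeries.ringHom_apply, map_prod, ← Finset.prod_mul_distrib]
  refine Finset.prod_congr rfl fun i _ => ?_
  rw [Polynomial.coeToPowerSeries.ringHom_apply, coe_lin_pow, ← negBin_add]
  ring_nf

/-- Lowering each exponent by a large K makes each factor decay. The threshold for K is uniform in P
because the Bézout polynomials are chosen after K and depend on it. -/
theorem exists_decay (hz : ∀ i, ‖z i‖ = 1) (a : ι → ℂ) {N : ℂ⟦X⟧} (hN : Fast N) (M : ℝ) :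
    ∃ K₀ : ℕ, ∀ K ≥ K₀, ∀ (j : ι) (P : Polynomial ℂ),
      Bd ((P : ℂ⟦X⟧) * N * ∏ i ∈ {j}ᶜ, negBin (z i) (a i - (K : ℕ))) (-M) := by
  have h := fun j : ι => exists_decay_prod ({j}ᶜ) (a := a) hz |M|
  choose K₀ hK using h
  refine ⟨Finset.univ.sup K₀, fun K hK' j P => ?_⟩
  have h1 := hK j K ((Finset.le_sup (f := K₀) (Finset.mem_univ j)).trans hK')
  rw [mul_comm]
  exact (Bd.mul_neg (abs_nonneg M) h1 (((fast_polynomial P).mul hN) _)).mono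
    (neg_le_neg (le_abs_self M))

/-- The partition of unity writes W as a sum of single-singularity series `negBin (z j) (a j)`, each
times a rapidly decaying factor. This is the source of stability. -/
theorem Bd_of_factorization [Nonempty ι] (hz : ∀ i, ‖z i‖ = 1) (hinj : Function.Injective z)
    {N W : ℂ⟦X⟧} (hN : Fast N) (hW : W = N * ∏ i, negBin (z i) (a i)) {b : ℝ}
    (hb : ∀ i, (a i).re ≤ b) : Bd W (b - 1) := by
  obtain ⟨K, hK⟩ := exists_decay hz a hN (|b - 1| + 2)
  have hK := hK K le_rfl
  obtain ⟨μ, hμ⟩ := exists_bezout hinj K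
  have e : W = ∑ j, negBin (z j) (a j) *
      ((μ j : ℂ⟦X⟧) * N * ∏ i ∈ {j}ᶜ, negBin (z i) (a i - (K : ℕ))) := by
    have h1 := congrArg (fun P : Polynomial ℂ => (P : ℂ⟦X⟧) * W) hμ
    simp only [Polynomial.coe_one, one_mul] at h1
    rw [← h1, ← Polynomial.coeToPowerSeries.ringHom_apply, map_sum, Finset.sum_mul]
    refine Finset.sum_congr rfl fun j _ => ?_
    have h2 := partition_mul_prod j z a K
    rw [map_mul, Polynomial.coeToPowerSeries.ringHom_apply,
      Polynomial.coeToPowerSeries.ringHom_apply, hW]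
    linear_combination (μ j : ℂ⟦X⟧) * N * h2
  rw [e]
  refine Bd.sum _ fun j _ => ?_
  refine Bd.mul ((Bd_negBin (hz j) (a j)).mono (by linarith [hb j])) (hK j (μ j)) le_rfl

end

/-! ### Asymptotics at the singularity 1 -/

section

open PowerSeries

theorem isBigO_pow_one_nhdsGT (m : ℕ) :
    (fun u : ℝ => u ^ m) =O[𝓝[>] 0] fun _ => (1 : ℝ) := by
  have : ContinuousAt (fun u : ℝ => u ^ m) 0 := by fun_prop
  exact (this.tendsto.mono_left nhdsWithin_le_nhds).isBigO_one ℝ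

theorem continuousAt_isBigO_one {f : ℂ → ℂ} (hf : ContinuousAt f 0) :
    (fun u : ℝ => f u) =O[𝓝[>] 0] fun _ => (1 : ℝ) := by
  have h : ContinuousAt (fun u : ℝ => f u) 0 :=
    ContinuousAt.comp (by simpa using hf) Complex.continuous_ofReal.continuousAt
  exact (h.tendsto.mono_left nhdsWithin_le_nhds).isBigO_one ℝ

/-- Uniqueness of asymptotic expansions. -/
theorem coeff_eq_zero_of_isBigO (m : ℕ) (e : ℕ → ℂ)
    (h : (fun u : ℝ => ∑ k ∈ Finset.range m, e k * (u : ℂ) ^ k) =O[𝓝[>] 0] fun u : ℝ => u ^ m) :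
    ∀ k < m, e k = 0 := by
  induction m generalizing e with
  | zero => simp
  | succ m ih =>
    have t0 : Tendsto (fun u : ℝ => u ^ (m + 1)) (𝓝[>] 0) (𝓝 0) := by
      have : ContinuousAt (fun u : ℝ => u ^ (m + 1)) 0 := by fun_prop
      simpa [ContinuousAt] using this.tendsto.mono_left (nhdsWithin_le_nhds (s := Set.Ioi 0))
    have t1 := h.trans_tendsto t0
    have t2 : Tendsto (fun u : ℝ => ∑ k ∈ Finset.range (m + 1), e k * (u : ℂ) ^ k) (𝓝[>] 0)
        (𝓝 (e 0)) := by
      have : ContinuousAt (fun u : ℝ => ∑ k ∈ Finset.range (m + 1), e k * (u : ℂ) ^ k) 0 := by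
        fun_prop
      have := this.tendsto.mono_left (nhdsWithin_le_nhds (s := Set.Ioi 0))
      rw [Finset.sum_range_succ'] at this
      simpa using this
    have h0 : e 0 = 0 := tendsto_nhds_unique t2 t1
    have h1 : (fun u : ℝ => ∑ k ∈ Finset.range m, e (k + 1) * (u : ℂ) ^ k) =O[𝓝[>] 0]
        fun u : ℝ => u ^ m := by
      have h2 : (fun u : ℝ => ((u : ℂ))⁻¹) =O[𝓝[>] 0] fun u : ℝ => u⁻¹ :=
        IsBigO.of_bound 1 (Eventually.of_forall fun u => by simp)
      refine (h2.mul h).congr' ?_ ?_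
      · filter_upwards [self_mem_nhdsWithin] with u hu
        have hu' : (u : ℂ) ≠ 0 := by exact_mod_cast (show (0 : ℝ) < u from hu).ne'
        rw [Finset.sum_range_succ', h0, zero_mul, add_zero, Finset.mul_sum]
        refine Finset.sum_congr rfl fun k _ => ?_
        rw [pow_succ]
        field_simp
      · filter_upwards [self_mem_nhdsWithin] with u hu
        have hu' : u ≠ 0 := (show (0 : ℝ) < u from hu).ne'
        rw [pow_succ]
        field_simp
    intro k hk
    cases k with
    | zero => exact h0
    | succ k => exact ih (fun k => e (k + 1)) h1 k (by lia)

theorem isBigO_mul_sub_mul {f f₁ h h₁ : ℝ → ℂ} {g : ℝ → ℝ} {l : Filter ℝ}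
    (hf : (fun u => f u - f₁ u) =O[l] g) (hh : (fun u => h u - h₁ u) =O[l] g)
    (hf₁ : f₁ =O[l] fun _ => (1 : ℝ)) (hb : h =O[l] fun _ => (1 : ℝ)) :
    (fun u => f u * h u - f₁ u * h₁ u) =O[l] g := by
  have h1 := hf.mul hb
  have h2 := hf₁.mul hh
  simp only [mul_one, one_mul] at h1 h2
  exact (h1.add h2).congr_left fun u => by ring

theorem isBigO_one_of_sub {f f₁ : ℝ → ℂ} {m : ℕ}
    (hf : (fun u => f u - f₁ u) =O[𝓝[>] 0] fun u : ℝ => u ^ m)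
    (hf₁ : f₁ =O[𝓝[>] 0] fun _ => (1 : ℝ)) : f =O[𝓝[>] 0] fun _ => (1 : ℝ) :=
  ((hf.trans (isBigO_pow_one_nhdsGT m)).add hf₁).congr_left fun u => by ring

theorem isBigO_pow_of_le {m k : ℕ} (h : m ≤ k) :
    (fun u : ℝ => u ^ k) =O[𝓝[>] 0] fun u : ℝ => u ^ m := by
  have := (isBigO_refl (fun u : ℝ => u ^ m) (𝓝[>] 0)).mul (isBigO_pow_one_nhdsGT (k - m))
  simpa [← pow_add, Nat.add_sub_cancel' h] using this

theorem sub_sum_tc_isBigO_nhdsGT {f : ℂ → ℂ} (hf : AnalyticAt ℂ f 0) (K : ℕ) :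
    (fun u : ℝ => f u - ∑ k ∈ Finset.range K, tc f k * (u : ℂ) ^ k) =O[𝓝[>] 0]
      fun u : ℝ => u ^ K := by
  have ht : Tendsto (fun u : ℝ => (u : ℂ)) (𝓝[>] 0) (𝓝 0) := by
    have := Complex.continuous_ofReal.tendsto 0
    simpa using this.mono_left (nhdsWithin_le_nhds (s := Set.Ioi 0))
  refine ((sub_sum_tc_isBigO hf K).comp_tendsto ht).trans (IsBigO.of_bound 1 ?_)
  exact Eventually.of_forall fun u => by simp

variable {ι : Type*} [Fintype ι] [DecidableEq ι] {z a : ι → ℂ}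

theorem eval_lin_pow_one_sub (u : ℂ) (K : ℕ) : (lin 1 ^ K).eval (1 - u) = u ^ K := by
  simp [lin]

/-- The elements of a partition of unity at the singularity `1`. -/
theorem partition_eval_isBigO {j₀ : ι} (hj₀ : z j₀ = 1) {K : ℕ} {μ : ι → Polynomial ℂ}
    (hμ : ∑ j, μ j * ∏ i ∈ {j}ᶜ, lin (z i) ^ K = 1) :
    (fun u : ℝ => (μ j₀ * ∏ i ∈ {j₀}ᶜ, lin (z i) ^ K).eval (1 - (u : ℂ)) - 1) =O[𝓝[>] 0]
      fun u : ℝ => u ^ K := by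
  -- Every summand with j ≠ j₀ contains `lin 1 ^ K`, which takes the value u^K at 1 - u; `Q`
  -- collects the cofactors.
  let Q : Polynomial ℂ := ∑ j ∈ {j₀}ᶜ, μ j * ∏ i ∈ ({j}ᶜ : Finset ι) \ {j₀}, lin (z i) ^ K
  have e : μ j₀ * ∏ i ∈ {j₀}ᶜ, lin (z i) ^ K = 1 - lin 1 ^ K * Q := by
    rw [← hμ, Fintype.sum_eq_add_sum_compl j₀, eq_sub_iff_add_eq]
    congr 1
    rw [Finset.mul_sum]
    refine Finset.sum_congr rfl fun j hj => ?_
    have hj' : j₀ ∈ ({j}ᶜ : Finset ι) := by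
      simp only [Finset.mem_compl, Finset.mem_singleton] at hj ⊢
      exact fun h => hj h.symm
    rw [Finset.prod_eq_mul_prod_sdiff_singleton_of_mem hj', hj₀]
    ring
  have hc : ContinuousAt (fun u : ℂ => Q.eval (1 - u)) 0 := by fun_prop
  have h1 : (fun u : ℝ => (u : ℂ) ^ K) =O[𝓝[>] 0] fun u : ℝ => u ^ K :=
    IsBigO.of_bound 1 (Eventually.of_forall fun u => by simp)
  have h2 := (h1.mul (continuousAt_isBigO_one hc)).neg_left
  simp only [mul_one] at h2
  refine h2.congr_left fun u => ?_
  rw [e, Polynomial.eval_sub, Polynomial.eval_mul, eval_lin_pow_one_sub]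
  simp

/-- The values `h^α e^(θ h) w(e^(-h)) ` as a function of `u = 1 - e^(-h)`. -/
noncomputable def consFun (α : ℂ) (θ : ℝ) (w : ℂ → ℂ) (u : ℝ) : ℂ :=
  shiftPow (-α) (-θ) u * ((u : ℂ) ^ α * w (1 - u))

theorem consFun_mul (α : ℂ) (θ : ℝ) (w : ℂ → ℂ) (u : ℝ) :
    consFun α θ w u * shiftPow α θ u = (u : ℂ) ^ α * w (1 - u) := by
  have := shiftPow_add (-α) α (-θ) θ u
  rw [neg_add_cancel, neg_add_cancel, shiftPow_zero_zero] at this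
  rw [consFun]
  linear_combination (-((u : ℂ) ^ α * w (1 - u))) * this

/-- Asymptotic expansion of a series `∑ d_k (1 - X)^k + (1 - X)^m r` at `1`. -/
theorem Rep.expansion_isBigO {G r : ℂ⟦X⟧} {g : ℂ → ℂ} {m : ℕ} {d : ℕ → ℂ} (hg : Rep G g)
    (hG : G = ∑ k ∈ Finset.range m, C (d k) * (1 - X) ^ k + (1 - X) ^ m * r) (hr : Bd r (-2)) :
    (fun u : ℝ => g (1 - u) - ∑ k ∈ Finset.range m, d k * (u : ℂ) ^ k) =O[𝓝[>] 0]
      fun u : ℝ => u ^ m := by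
  obtain ⟨ρ, hρ⟩ := hr.exists_rep
  obtain ⟨D, hD⟩ := hρ.bounded hr
  let P : Polynomial ℂ := ∑ k ∈ Finset.range m, Polynomial.C (d k) * lin 1 ^ k
  have h1 := (rep_polynomial P).add ((rep_polynomial (lin 1 ^ m)).mul hρ)
  have e : (P : ℂ⟦X⟧) + ((lin 1 ^ m : Polynomial ℂ) : ℂ⟦X⟧) * r = G := by
    rw [hG, ← Polynomial.coeToPowerSeries.ringHom_apply, map_sum]
    simp [lin]
  rw [e] at h1
  refine IsBigO.of_bound D ?_
  filter_upwards [Ioo_mem_nhdsGT (zero_lt_one (α := ℝ))] with u hu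
  have hn : ‖(1 : ℂ) - u‖ < 1 := by
    rw [← Complex.ofReal_one, ← Complex.ofReal_sub, Complex.norm_real, Real.norm_eq_abs, abs_lt]
    constructor <;> linarith [hu.1, hu.2]
  have h2 := (hg _ hn).unique (h1 _ hn)
  have h3 : P.eval (1 - (u : ℂ)) = ∑ k ∈ Finset.range m, d k * (u : ℂ) ^ k := by
    rw [Polynomial.eval_finsetSum]
    simp only [Polynomial.eval_mul, eval_lin_pow_one_sub, Polynomial.eval_C]
  rw [h2]
  simp only
  rw [h3, eval_lin_pow_one_sub, add_sub_cancel_left, norm_mul, mul_comm D]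
  gcongr
  · simp
  · exact hD _ hn

/-- `w = ν ∏ (1 - z_i ξ)^(-a_i)` in the unit disc, with `ν` having rapidly decaying coefficients. -/
structure Factored (z a : ι → ℂ) (j₀ : ι) (N W : ℂ⟦X⟧) (w : ℂ → ℂ) : Prop where
  norm_eq_one : ∀ i, ‖z i‖ = 1
  injective : Function.Injective z
  base : z j₀ = 1
  fast : Fast N
  rep : Rep W w
  eq_mul : W = N * ∏ i, negBin (z i) (a i)
  re_le : ∀ i, (a i).re ≤ (a j₀).re

/-- At 1 - u the series G equals u^α w(1 - u) = `consFun` · `shiftPow α θ`, times a partition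
element 1 + O(u^K) and a Taylor polynomial of `shiftPow β 0`. The product is (1 + γ u^q) `shiftPow
(α + β) θ` up to O(u^(q+1)), and uniqueness of asymptotic expansions identifies the `d k`. -/
theorem Factored.expansion_coeff {j₀ : ι} {N W : ℂ⟦X⟧} {w : ℂ → ℂ} (H : Factored z a j₀ N W w)
    {θ : ℝ} {q : ℕ} {γ : ℂ}
    (hκ : (fun u : ℝ => consFun (a j₀) θ w u - (1 + γ * (u : ℂ) ^ q)) =O[𝓝[>] 0]
      fun u : ℝ => u ^ (q + 1))
    {β : ℂ} {K L : ℕ} (hK : q + 1 ≤ K) (hL : q + 1 ≤ L) {μ : ι → Polynomial ℂ}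
    (hμ : ∑ j, μ j * ∏ i ∈ {j}ᶜ, lin (z i) ^ K = 1) {T G r : ℂ⟦X⟧}
    (hT : T = ∑ k ∈ Finset.range L, C (tc (shiftPow β 0) k) * (1 - X) ^ k)
    (hG : G = (μ j₀ : ℂ⟦X⟧) * (N * T) * ∏ i ∈ {j₀}ᶜ, negBin (z i) (a i - (K : ℕ)))
    {d : ℕ → ℂ}
    (hd : G = ∑ k ∈ Finset.range (q + 1), C (d k) * (1 - X) ^ k + (1 - X) ^ (q + 1) * r)
    (hr : Bd r (-2)) {k : ℕ} (hk : k < q + 1) :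
    d k = tc (shiftPow (a j₀ + β) θ) k + if k = q then γ else 0 := by
  set α := a j₀ with hα
  set e₀ := μ j₀ * ∏ i ∈ {j₀}ᶜ, lin (z i) ^ K with he₀
  let P : Polynomial ℂ := ∑ k ∈ Finset.range L, Polynomial.C (tc (shiftPow β 0) k) * lin 1 ^ k
  have hP : (P : ℂ⟦X⟧) = T := by
    rw [hT, ← Polynomial.coeToPowerSeries.ringHom_apply, map_sum]
    simp [lin]
  have hG' : ((e₀ * P : Polynomial ℂ) : ℂ⟦X⟧) * (W * negBin 1 (-α)) = G := by
    have h1 := partition_mul_prod j₀ z a K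
    have h2 : negBin 1 α * negBin 1 (-α) = 1 := by rw [← negBin_add, add_neg_cancel, negBin_zero]
    rw [H.base] at h1
    rw [Polynomial.coe_mul, he₀, Polynomial.coe_mul, hP, H.eq_mul, hG]
    linear_combination ((μ j₀ : ℂ⟦X⟧) * T * N * negBin 1 (-α)) * h1 +
      ((μ j₀ : ℂ⟦X⟧) * T * N * ∏ i ∈ {j₀}ᶜ, negBin (z i) (a i - (K : ℕ))) * h2
  have hg := (rep_polynomial (e₀ * P)).mul (H.rep.mul (rep_negBin norm_one (-α)))
  rw [hG'] at hg
  have h1 := hg.expansion_isBigO hd hr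
  have b1 : (fun u : ℝ => e₀.eval (1 - (u : ℂ)) - 1) =O[𝓝[>] 0] fun u : ℝ => u ^ (q + 1) :=
    (partition_eval_isBigO H.base hμ).trans (isBigO_pow_of_le hK)
  have b2 : (fun u : ℝ => P.eval (1 - (u : ℂ)) - shiftPow β 0 u) =O[𝓝[>] 0]
      fun u : ℝ => u ^ (q + 1) := by
    have := ((sub_sum_tc_isBigO_nhdsGT (analyticAt_shiftPow β 0) L).trans
      (isBigO_pow_of_le hL)).neg_left
    refine this.congr_left fun u => ?_
    rw [Polynomial.eval_finsetSum]
    simp only [Polynomial.eval_mul, eval_lin_pow_one_sub, Polynomial.eval_C]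
    ring
  have c1 : (fun _ : ℝ => (1 : ℂ)) =O[𝓝[>] 0] fun _ => (1 : ℝ) := by
    simpa using isBigO_const_const (1 : ℂ) (one_ne_zero (α := ℝ)) _
  have c2 : ∀ s η : ℂ, (fun u : ℝ => shiftPow s η u) =O[𝓝[>] 0] fun _ => (1 : ℝ) := fun s η =>
    continuousAt_isBigO_one (analyticAt_shiftPow s η).continuousAt
  have c3 : (fun u : ℝ => 1 + γ * (u : ℂ) ^ q) =O[𝓝[>] 0] fun _ => (1 : ℝ) :=
    continuousAt_isBigO_one (f := fun u => 1 + γ * u ^ q) (by fun_prop)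
  have b3 := isBigO_mul_sub_mul b1 b2 c1 (isBigO_one_of_sub b2 (c2 β 0))
  have b4 : (fun u : ℝ => consFun α θ w u * shiftPow α θ u -
      (1 + γ * (u : ℂ) ^ q) * shiftPow α θ u) =O[𝓝[>] 0] fun u : ℝ => u ^ (q + 1) :=
    isBigO_mul_sub_mul hκ (by simpa using isBigO_zero _ _) c3 (c2 α θ)
  have c4 : (fun u : ℝ => (1 : ℂ) * shiftPow β 0 u) =O[𝓝[>] 0] fun _ => (1 : ℝ) := by
    simpa using c2 β 0
  have c5 := (c3.mul (c2 α θ))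
  simp only [mul_one] at c5
  have b5 := isBigO_mul_sub_mul b3 b4 c4 (isBigO_one_of_sub b4 c5)
  have b6 := sub_sum_tc_isBigO_nhdsGT (analyticAt_shiftPow (α + β) θ) (q + 1)
  have b7 : (fun u : ℝ => γ * (u : ℂ) ^ q * (shiftPow (α + β) θ u - 1)) =O[𝓝[>] 0]
      fun u : ℝ => u ^ (q + 1) := by
    have t1 := sub_sum_tc_isBigO_nhdsGT (analyticAt_shiftPow (α + β) θ) 1
    simp only [Finset.range_one, Finset.sum_singleton, tc_shiftPow_zero, pow_zero, mul_one,
      pow_one] at t1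
    have t2 : (fun u : ℝ => γ * (u : ℂ) ^ q) =O[𝓝[>] 0] fun u : ℝ => u ^ q :=
      IsBigO.of_bound ‖γ‖ (Eventually.of_forall fun u => by simp)
    exact t2.mul t1
  let e : ℕ → ℂ := fun k => d k - tc (shiftPow (α + β) θ) k - if k = q then γ else 0
  have key : (fun u : ℝ => ∑ k ∈ Finset.range (q + 1), e k * (u : ℂ) ^ k) =O[𝓝[>] 0]
      fun u : ℝ => u ^ (q + 1) := by
    refine (((b5.sub h1).add b6).add b7).congr_left fun u => ?_
    have s1 : ∑ k ∈ Finset.range (q + 1), e k * (u : ℂ) ^ k =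
        ∑ k ∈ Finset.range (q + 1), d k * (u : ℂ) ^ k -
        ∑ k ∈ Finset.range (q + 1), tc (shiftPow (α + β) θ) k * (u : ℂ) ^ k - γ * (u : ℂ) ^ q := by
      simp only [e, sub_mul, Finset.sum_sub_distrib, ite_mul, zero_mul]
      congr 1
      rw [Finset.sum_ite_eq' _ q]
      simp
    have s2 := shiftPow_add α β θ 0 u
    rw [add_zero] at s2
    have s3 : 1 - 1 * (1 - (u : ℂ)) = u := by ring
    rw [s1, consFun_mul, Polynomial.eval_mul (p := e₀) (q := P), neg_neg, one_mul, s3, s2]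
    ring
  have := coeff_eq_zero_of_isBigO (q + 1) e key k hk
  simp only [e] at this
  linear_combination this

end

/-! ### Coefficients of the product, and consistency in the variable u -/

section

open PowerSeries

variable {ι : Type*} [Fintype ι] [DecidableEq ι] {z a : ι → ℂ}

theorem Factored.bd {j₀ : ι} {N W : ℂ⟦X⟧} {w : ℂ → ℂ} (H : Factored z a j₀ N W w) :
    Bd W ((a j₀).re - 1) :=
  have : Nonempty ι := ⟨j₀⟩
  Bd_of_factorization H.norm_eq_one H.injective H.fast H.eq_mul H.re_le

theorem rpow_isBigO_rpow {x y : ℝ} (h : x ≤ y) :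
    (fun n : ℕ => (n : ℝ) ^ x) =O[atTop] fun n : ℕ => (n : ℝ) ^ y := by
  refine IsBigO.of_bound 1 ?_
  filter_upwards [eventually_ge_atTop 1] with n hn
  have hn' : (1 : ℝ) ≤ n := by exact_mod_cast hn
  rw [Real.norm_of_nonneg (by positivity), Real.norm_of_nonneg (by positivity), one_mul]
  exact Real.rpow_le_rpow_of_exponent_le hn' h

theorem isBigO_add_left (x y : ℝ) :
    (fun n : ℕ => (n : ℝ) ^ x) =O[atTop] fun n : ℕ => (n : ℝ) ^ x + (n : ℝ) ^ y := by
  refine IsBigO.of_bound 1 (Eventually.of_forall fun n => ?_)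
  have h1 : 0 ≤ (n : ℝ) ^ x := by positivity
  have h2 : 0 ≤ (n : ℝ) ^ y := by positivity
  rw [Real.norm_of_nonneg h1, Real.norm_of_nonneg (by positivity)]
  linarith

theorem isBigO_add_right (x y : ℝ) :
    (fun n : ℕ => (n : ℝ) ^ y) =O[atTop] fun n : ℕ => (n : ℝ) ^ x + (n : ℝ) ^ y := by
  simpa only [add_comm] using isBigO_add_left y x

/-- The coefficients of `ω` times the series of samples of the power function. -/
theorem Factored.conv_isBigO {j₀ : ι} {N W : ℂ⟦X⟧} {w : ℂ → ℂ} (H : Factored z a j₀ N W w)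
    {θ : ℝ} {q : ℕ} {γ : ℂ}
    (hκ : (fun u : ℝ => consFun (a j₀) θ w u - (1 + γ * (u : ℂ) ^ q)) =O[𝓝[>] 0]
      fun u : ℝ => u ^ (q + 1))
    {β : ℂ} (hβ : ∀ m : ℕ, β ≠ -(m : ℂ)) :
    (fun n : ℕ => coeff n (W * PowerSeries.mk fun n : ℕ => powFun β n) -
      (Complex.Gamma β / Complex.Gamma (a j₀ + β) * ((n - θ : ℝ) : ℂ) ^ (a j₀ + β - 1) +
        Complex.Gamma β * γ * bc (a j₀ + β - q) n)) =O[atTop]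
      fun n : ℕ => (n : ℝ) ^ ((a j₀ + β).re - 1 - (q + 1 : ℕ)) + (n : ℝ) ^ ((a j₀).re - 1) := by
  have : Nonempty ι := ⟨j₀⟩
  set α := a j₀ with hα
  set s := α + β with hs
  set B := ∑ i, |(a i).re| with hB
  have hBi : ∀ i, |(a i).re| ≤ B := fun i =>
    Finset.single_le_sum (f := fun i => |(a i).re|) (fun i _ => abs_nonneg _) (Finset.mem_univ i)
  -- The decay budget: 2(q+1) is lost in expanding `G j₀`, a further |s.re| + (q+1) in multiplying
  -- its remainder by `negBin 1 (s - (q+1))`, and `B` covers the exponents at the other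
  -- singularities.
  set M := B + |s.re| + 3 * (q + 1 : ℕ) + 10 with hM
  have hB0 : 0 ≤ B := (abs_nonneg _).trans (hBi j₀)
  have hs0 := abs_nonneg s.re
  obtain ⟨L₀, hL₀⟩ := mk_powFun_eq hβ M
  obtain ⟨R, hR, hA⟩ := hL₀ (max L₀ (q + 1)) (le_max_left _ _)
  set T := ∑ k ∈ Finset.range (max L₀ (q + 1)), C (tc (shiftPow β 0) k) * (1 - X : ℂ⟦X⟧) ^ k with hT
  have hTfast : Fast T := by
    let P : Polynomial ℂ :=
      ∑ k ∈ Finset.range (max L₀ (q + 1)), Polynomial.C (tc (shiftPow β 0) k) * lin 1 ^ k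
    have hP : (P : ℂ⟦X⟧) = T := by
      rw [hT, ← Polynomial.coeToPowerSeries.ringHom_apply, map_sum]
      simp [lin]
    rw [← hP]
    exact fast_polynomial P
  -- The factor (1 - X)^(-β) of the samples merges with the singularity at 1, whose exponent becomes
  -- s = α + β.
  obtain ⟨K₁, hK₁⟩ := exists_decay H.norm_eq_one (Function.update a j₀ s) (H.fast.mul hTfast) M
  set K := max K₁ (q + 1) with hK
  have hKb := hK₁ K (le_max_left _ _)
  obtain ⟨μ, hμ⟩ := exists_bezout H.injective K
  set a' := Function.update a j₀ s with ha'
  let G : ι → ℂ⟦X⟧ := fun j =>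
    (μ j : ℂ⟦X⟧) * (N * T) * ∏ i ∈ {j}ᶜ, negBin (z i) (a' i - (K : ℕ))
  have hGj₀ : G j₀ = (μ j₀ : ℂ⟦X⟧) * (N * T) * ∏ i ∈ {j₀}ᶜ, negBin (z i) (a i - (K : ℕ)) := by
    simp only [G]
    congr 1
    refine Finset.prod_congr rfl fun i hi => ?_
    rw [ha', Function.update_of_ne (by simpa using hi)]
  have hGbd : ∀ j, Bd (G j) (-M) := fun j => hKb j (μ j)
  obtain ⟨d, r, hd, hr⟩ := (hGbd j₀).exists_expansion (q + 1) (by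
    have : (0 : ℝ) ≤ (q + 1 : ℕ) := by positivity
    linarith)
  have hq0 : (0 : ℝ) ≤ (q + 1 : ℕ) := by positivity
  have hdk : ∀ k < q + 1, d k = tc (shiftPow s θ) k + if k = q then γ else 0 := fun k hk =>
    H.expansion_coeff hκ (le_max_right _ _) (le_max_right _ _) hμ hT hGj₀ hd
      (hr.mono (by linarith)) hk
  have hprod : negBin 1 β * ∏ i, negBin (z i) (a i) = ∏ i, negBin (z i) (a' i) := by
    rw [Fintype.prod_eq_mul_prod_compl j₀, Fintype.prod_eq_mul_prod_compl j₀, ← mul_assoc, H.base,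
      ← negBin_add, ha', Function.update_self, hs, add_comm β]
    congr 1
    refine Finset.prod_congr rfl fun i hi => ?_
    rw [Function.update_of_ne (by simpa using hi)]
  have hsum : N * T * ∏ i, negBin (z i) (a' i) = ∑ j, negBin (z j) (a' j) * G j := by
    have h1 := congrArg (fun P : Polynomial ℂ => (P : ℂ⟦X⟧) * (N * T * ∏ i, negBin (z i) (a' i))) hμ
    simp only [Polynomial.coe_one, one_mul] at h1
    rw [← h1, ← Polynomial.coeToPowerSeries.ringHom_apply, map_sum, Finset.sum_mul]
    refine Finset.sum_congr rfl fun j _ => ?_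
    have h2 := partition_mul_prod j z a' K
    rw [map_mul, Polynomial.coeToPowerSeries.ringHom_apply,
      Polynomial.coeToPowerSeries.ringHom_apply]
    simp only [G]
    linear_combination (μ j : ℂ⟦X⟧) * (N * T) * h2
  -- In order: the expansion at 1, its remainder, the other singularities, and the rapidly decaying
  -- remainder of the samples.
  have hmain : W * (PowerSeries.mk fun n : ℕ => powFun β n) =
      C (Complex.Gamma β) * ∑ k ∈ Finset.range (q + 1), C (d k) * negBin 1 (s - k) +
      (C (Complex.Gamma β) * (negBin 1 (s - (q + 1 : ℕ)) * r) +
      (C (Complex.Gamma β) * ∑ j ∈ {j₀}ᶜ, negBin (z j) (a' j) * G j + W * R)) := by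
    have e1 : negBin (z j₀) (a' j₀) * G j₀ = ∑ k ∈ Finset.range (q + 1), C (d k) * negBin 1 (s - k) +
        negBin 1 (s - (q + 1 : ℕ)) * r := by
      rw [H.base, ha', Function.update_self, hd, mul_add, Finset.mul_sum, sub_eq_add_neg s,
        negBin_add 1 s, negBin_one_neg_natCast]
      congr 1
      · refine Finset.sum_congr rfl fun k _ => ?_
        rw [sub_eq_add_neg s, negBin_add 1 s, negBin_one_neg_natCast]
        ring
      · ring
    have e2 : W * (C (Complex.Gamma β) * (negBin 1 β * T) + R) =
        C (Complex.Gamma β) * (N * T * (negBin 1 β * ∏ i, negBin (z i) (a i))) + W * R := by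
      rw [H.eq_mul]
      ring
    rw [hA, e2, hprod, hsum, Fintype.sum_eq_add_sum_compl j₀, e1]
    ring
  have o1 : (fun n : ℕ => coeff n (negBin 1 (s - (q + 1 : ℕ)) * r)) =O[atTop]
      fun n : ℕ => (n : ℝ) ^ (s.re - 1 - (q + 1 : ℕ)) := by
    refine (Bd.mul ((Bd_negBin norm_one _).mono ?_) hr ?_).isBigO
    · simp only [Complex.sub_re, Complex.natCast_re]
      linarith
    · have : |s.re - 1 - (q + 1 : ℕ)| ≤ |s.re| + 1 + (q + 1 : ℕ) := by
        rw [abs_le]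
        constructor <;> linarith [neg_abs_le s.re, le_abs_self s.re]
      linarith
  have o2 : (fun n : ℕ => coeff n (∑ j ∈ {j₀}ᶜ, negBin (z j) (a' j) * G j)) =O[atTop]
      fun n : ℕ => (n : ℝ) ^ (α.re - 1) := by
    refine (Bd.sum _ fun j hj => ?_).isBigO
    rw [ha', Function.update_of_ne (by simpa using hj)]
    refine Bd.mul ((Bd_negBin (H.norm_eq_one j) (a j)).mono (by linarith [H.re_le j])) (hGbd j) ?_
    have : |α.re - 1| ≤ |α.re| + 1 := by
      rw [abs_le]
      constructor <;> linarith [neg_abs_le α.re, le_abs_self α.re]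
    linarith [hBi j₀]
  have o3 : (fun n : ℕ => coeff n (W * R)) =O[atTop] fun n : ℕ => (n : ℝ) ^ (α.re - 1) := by
    refine (Bd.mul H.bd hR ?_).isBigO
    have : |α.re - 1| ≤ |α.re| + 1 := by
      rw [abs_le]
      constructor <;> linarith [neg_abs_le α.re, le_abs_self α.re]
    linarith [hBi j₀]
  have o4 := hasBinExpansion s θ (q + 1)
  have t1 := (o4.add o1).const_mul_left (Complex.Gamma β)
  have t2 := (o2.const_mul_left (Complex.Gamma β)).add o3
  refine ((t1.trans (isBigO_add_left _ _)).add (t2.trans (isBigO_add_right _ _))).congr_left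
    fun n => ?_
  have hdsum : ∑ k ∈ Finset.range (q + 1), d k * bc (s - k) n =
      ∑ k ∈ Finset.range (q + 1), tc (shiftPow s θ) k * bc (s - k) n + γ * bc (s - q) n := by
    rw [Finset.sum_congr rfl fun k hk => by rw [hdk k (Finset.mem_range.1 hk), add_mul],
      Finset.sum_add_distrib]
    simp only [ite_mul, zero_mul]
    rw [Finset.sum_ite_eq' _ q]
    simp
  rw [hmain]
  simp only [map_add, coeff_C_mul, map_sum]
  simp only [show ∀ c, coeff n (negBin 1 c) = bc c n from fun _ => rfl]
  rw [hdsum]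
  ring

/-- The real part of 1 - z is positive. Hence the principal powers belonging to the other
singularities are analytic near ξ = 1. -/
theorem one_sub_mem_slitPlane {z : ℂ} (hz : ‖z‖ = 1) (h1 : z ≠ 1) : 1 - z ∈ Complex.slitPlane := by
  left
  have h2 : z.re < 1 := by
    refine lt_of_le_of_ne (hz ▸ Complex.re_le_norm z) fun h => h1 ?_
    have h3 := Complex.sq_norm z
    rw [hz, Complex.normSq_apply, h] at h3
    have h4 : z.im = 0 := by nlinarith
    exact Complex.ext (by simpa using h) (by simpa using h4)
  simpa using h2

/-- `consFun` extends analytically to `u = 0`. -/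
theorem exists_analyticAt_consFun {j₀ : ι} {ν w : ℂ → ℂ} (hν : AnalyticAt ℂ ν 1)
    (hz : ∀ i, ‖z i‖ = 1) (hinj : Function.Injective z) (h0 : z j₀ = 1)
    (hw : ∀ ξ : ℂ, ‖ξ‖ < 1 → w ξ = ν ξ * ∏ i, (1 - z i * ξ) ^ (-(a i))) (θ : ℝ) :
    ∃ F : ℂ → ℂ, AnalyticAt ℂ F 0 ∧ ∀ᶠ u : ℝ in 𝓝[>] 0, consFun (a j₀) θ w u = F u := by
  refine ⟨fun u => shiftPow (-a j₀) (-θ) u *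
    (ν (1 - u) * ∏ i ∈ {j₀}ᶜ, (1 - z i * (1 - u)) ^ (-(a i))), ?_, ?_⟩
  · refine (analyticAt_shiftPow _ _).mul (AnalyticAt.mul ?_ ?_)
    · exact AnalyticAt.fun_comp (by simpa using hν) (analyticAt_const.sub analyticAt_id)
    · refine Finset.analyticAt_fun_prod _ fun i hi => AnalyticAt.cpow ?_ analyticAt_const ?_
      · exact analyticAt_const.sub (analyticAt_const.mul (analyticAt_const.sub analyticAt_id))
      · rw [sub_zero, mul_one]
        refine one_sub_mem_slitPlane (hz i) fun h => ?_
        simp only [Finset.mem_compl, Finset.mem_singleton] at hi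
        exact hi (hinj (h.trans h0.symm))
  · filter_upwards [Ioo_mem_nhdsGT (zero_lt_one (α := ℝ))] with u hu
    have hn : ‖(1 : ℂ) - u‖ < 1 := by
      rw [← Complex.ofReal_one, ← Complex.ofReal_sub, Complex.norm_real, Real.norm_eq_abs, abs_lt]
      constructor <;> linarith [hu.1, hu.2]
    have hu0 : (u : ℂ) ≠ 0 := by exact_mod_cast hu.1.ne'
    have e : (1 : ℂ) - 1 * (1 - u) = u := by ring
    have e2 : (u : ℂ) ^ (a j₀) * (u : ℂ) ^ (-(a j₀)) = 1 := by
      rw [← Complex.cpow_add _ _ hu0, add_neg_cancel, Complex.cpow_zero]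
    rw [consFun, hw _ hn, Fintype.prod_eq_mul_prod_compl j₀, h0, e]
    linear_combination (shiftPow (-a j₀) (-θ) u *
      (ν (1 - u) * ∏ i ∈ {j₀}ᶜ, (1 - z i * (1 - u)) ^ (-(a i)))) * e2

/-- The leading term of the deviation of an analytic function from `1`. -/
theorem exists_leading_term {F : ℂ → ℂ} (hF : AnalyticAt ℂ F 0) {q : ℕ}
    (h : (fun u : ℝ => F u - 1) =O[𝓝[>] 0] fun u : ℝ => u ^ q) :
    ∃ γ : ℂ, (fun u : ℝ => F u - (1 + γ * (u : ℂ) ^ q)) =O[𝓝[>] 0] fun u : ℝ => u ^ (q + 1) := by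
  have hF' : AnalyticAt ℂ (fun u => F u - 1) 0 := hF.sub analyticAt_const
  have h1 := sub_sum_tc_isBigO_nhdsGT hF' q
  -- The one-sided real bound already kills all Taylor coefficients of F - 1 below order q; γ is the
  -- q-th one.
  have h2 := coeff_eq_zero_of_isBigO q (tc fun u => F u - 1) ((h.sub h1).congr_left fun u => by ring)
  refine ⟨tc (fun u => F u - 1) q, (sub_sum_tc_isBigO_nhdsGT hF' (q + 1)).congr_left fun u => ?_⟩
  rw [Finset.sum_range_succ, Finset.sum_eq_zero fun k hk => by
    rw [h2 k (Finset.mem_range.1 hk), zero_mul]]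
  ring

theorem tendsto_one_sub_exp : Tendsto (fun h : ℝ => 1 - Real.exp (-h)) (𝓝[>] 0) (𝓝[>] 0) := by
  refine tendsto_nhdsWithin_iff.2 ⟨?_, ?_⟩
  · have : Continuous fun h : ℝ => 1 - Real.exp (-h) := by fun_prop
    simpa using (this.tendsto 0).mono_left (nhdsWithin_le_nhds (s := Set.Ioi 0))
  · filter_upwards [self_mem_nhdsWithin] with h hh
    have hh : 0 < h := hh
    exact sub_pos.2 (Real.exp_lt_one_iff.2 (by linarith))

theorem tendsto_neg_log_one_sub : Tendsto (fun u : ℝ => -Real.log (1 - u)) (𝓝[>] 0) (𝓝[>] 0) := by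
  refine tendsto_nhdsWithin_iff.2 ⟨?_, ?_⟩
  · have : ContinuousAt (fun u : ℝ => -Real.log (1 - u)) 0 :=
      (ContinuousAt.log (by fun_prop) (by simp)).neg
    simpa using this.tendsto.mono_left (nhdsWithin_le_nhds (s := Set.Ioi 0))
  · filter_upwards [Ioo_mem_nhdsGT (zero_lt_one (α := ℝ))] with u hu
    exact neg_pos.2 (Real.log_neg (by linarith [hu.2]) (by linarith [hu.1]))

theorem consFun_one_sub_exp (α : ℂ) (θ : ℝ) (w : ℂ → ℂ) {h : ℝ} (hh : 0 < h) :
    consFun α θ w (1 - Real.exp (-h)) =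
      (h : ℂ) ^ α * Complex.exp (θ * h) * w (Complex.exp (-h)) := by
  have hu : 0 < 1 - Real.exp (-h) := sub_pos.2 (Real.exp_lt_one_iff.2 (by linarith))
  rw [consFun, shiftPow_one_sub_exp hh.ne']
  have e1 : (1 : ℂ) - ((1 - Real.exp (-h) : ℝ) : ℂ) = Complex.exp (-h) := by push_cast; ring
  rw [e1, ← mul_assoc]
  congr 1
  rw [Complex.cpow_def_of_ne_zero (by exact_mod_cast hu.ne'),
    Complex.cpow_def_of_ne_zero (by exact_mod_cast hh.ne'), ← Complex.ofReal_log hu.le,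
    ← Complex.ofReal_log hh.le, ← Complex.exp_add, ← Complex.exp_add,
    Real.log_div hh.ne' hu.ne']
  push_cast
  ring_nf

/-- Consistency in terms of the variable `u = 1 - e^(-h)`. -/
theorem consistent_iff (α : ℂ) (θ : ℝ) (w : ℂ → ℂ) (p : ℕ) :
    ((fun h : ℝ => (h : ℂ) ^ α * Complex.exp (θ * h) * w (Complex.exp (-h)) - 1)
      =O[𝓝[>] 0] fun h : ℝ => h ^ p) ↔
    (fun u : ℝ => consFun α θ w u - 1) =O[𝓝[>] 0] fun u : ℝ => u ^ p := by
  have key : (fun h : ℝ => (h : ℂ) ^ α * Complex.exp (θ * h) * w (Complex.exp (-h)) - 1) =ᶠ[𝓝[>] 0]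
      fun h => consFun α θ w (1 - Real.exp (-h)) - 1 := by
    filter_upwards [self_mem_nhdsWithin] with h hh
    rw [consFun_one_sub_exp α θ w hh]
  constructor
  · intro h
    have h1 := (h.congr' key EventuallyEq.rfl).comp_tendsto tendsto_neg_log_one_sub
    have h2 : (fun u : ℝ => -Real.log (1 - u)) =O[𝓝[>] 0] fun u : ℝ => u := by
      have hd : HasDerivAt (fun u : ℝ => -Real.log (1 - u)) (-(-1 / (1 - 0))) 0 :=
        (((hasDerivAt_id (0 : ℝ)).const_sub 1).log (by simp)).neg
      have := hd.isBigO_sub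
      simp only [sub_zero, Real.log_one, neg_zero] at this
      exact this.mono nhdsWithin_le_nhds
    refine (h1.congr' ?_ EventuallyEq.rfl).trans (h2.pow p)
    filter_upwards [Ioo_mem_nhdsGT (zero_lt_one (α := ℝ))] with u hu
    simp only [Function.comp]
    rw [neg_neg, Real.exp_log (by linarith [hu.2]), sub_sub_cancel]
  · intro h
    have h1 := h.comp_tendsto tendsto_one_sub_exp
    have h2 : (fun h : ℝ => 1 - Real.exp (-h)) =O[𝓝[>] 0] fun h : ℝ => h := by
      have hd : HasDerivAt (fun h : ℝ => 1 - Real.exp (-h)) (-(Real.exp (-0) * -1)) 0 :=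
        ((hasDerivAt_neg (0 : ℝ)).exp).const_sub 1
      have := hd.isBigO_sub
      simp only [sub_zero, Real.exp_zero, neg_zero, sub_self] at this
      exact this.mono nhdsWithin_le_nhds
    exact (h1.trans (h2.pow p)).congr' key.symm EventuallyEq.rfl

end

/-! ### The Riemann–Liouville operator on powers -/

section

/-- The functions x^c / Γ(c + 1) are permuted by differentiation without exceptional exponents,
because 1/Γ(c) = c/Γ(c + 1) holds at the poles as well. -/
theorem hasDerivAt_cpow_div_Gamma (A c : ℂ) {x : ℝ} (hx : 0 < x) :
    HasDerivAt (fun y : ℝ => A * ((y : ℂ) ^ c / Complex.Gamma (c + 1)))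
      (A * ((x : ℂ) ^ (c - 1) / Complex.Gamma c)) x := by
  have h1 : HasDerivAt (fun y : ℝ => (y : ℂ) ^ c) (c * (x : ℂ) ^ (c - 1) * 1) x :=
    ((hasDerivAt_id (x : ℂ)).cpow_const (by left; simpa using hx)).comp_ofReal
  refine ((h1.div_const (Complex.Gamma (c + 1))).const_mul A).congr_deriv ?_
  have h2 := Complex.one_div_Gamma_eq_self_mul_one_div_Gamma_add_one c
  rw [div_eq_mul_inv _ (Complex.Gamma c), h2]
  ring

theorem iteratedDeriv_of_eq_cpow (A c : ℂ) (k : ℕ) {f : ℝ → ℂ}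
    (hf : ∀ x : ℝ, 0 < x → f x = A * ((x : ℂ) ^ (c + k - 1) / Complex.Gamma (c + k))) :
    ∀ x : ℝ, 0 < x → iteratedDeriv k f x = A * ((x : ℂ) ^ (c - 1) / Complex.Gamma c) := by
  induction k generalizing f with
  | zero => simpa using hf
  | succ k ih =>
    intro x hx
    rw [iteratedDeriv_succ']
    refine ih (fun y hy => ?_) x hx
    have e : f =ᶠ[𝓝 y] fun y : ℝ => A * ((y : ℂ) ^ (c + k) / Complex.Gamma (c + k + 1)) := by
      filter_upwards [lt_mem_nhds hy] with t ht
      rw [hf t ht]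
      push_cast
      ring_nf
    rw [e.deriv_eq]
    exact (hasDerivAt_cpow_div_Gamma A (c + k) hy).deriv

theorem rlIntegral_powFun {α β : ℂ} (hα : 0 < α.re) (hβ : 0 < β.re) {x : ℝ} (hx : 0 < x) :
    rlIntegral α (powFun β) x =
      Complex.Gamma β * ((x : ℂ) ^ (α + β - 1) / Complex.Gamma (α + β)) := by
  have h1 := Complex.betaIntegral_scaled β α hx
  rw [Complex.betaIntegral_eq_Gamma_mul_div β α hβ hα] at h1
  have h2 : ∫ s in (0 : ℝ)..x, ((x - s : ℝ) : ℂ) ^ (α - 1) * powFun β s =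
      ∫ s in (0 : ℝ)..x, (s : ℂ) ^ (β - 1) * ((x : ℂ) - s) ^ (α - 1) := by
    congr 1
    funext s
    rw [powFun, mul_comm]
    push_cast
    rfl
  have h3 := Complex.Gamma_ne_zero_of_re_pos hα
  rw [rlIntegral, h2, h1, add_comm β α]
  field_simp

theorem re_add_floor_pos (α : ℂ) : 0 < (α + (⌊-α.re⌋₊ + 1 : ℕ)).re := by
  have := Nat.lt_floor_add_one (-α.re)
  simp only [Complex.add_re, Complex.natCast_re]
  push_cast
  linarith

theorem rlOperator_powFun (α : ℂ) {β : ℂ} (hβ : 0 < β.re) {x : ℝ} (hx : 0 < x) :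
    rlOperator α (powFun β) x =
      Complex.Gamma β * ((x : ℂ) ^ (α + β - 1) / Complex.Gamma (α + β)) := by
  rw [rlOperator]
  split_ifs with h1 h2
  · exact rlIntegral_powFun h1 hβ hx
  · have := Complex.Gamma_ne_zero_of_re_pos hβ
    rw [h2, zero_add, powFun]
    field_simp
  · refine iteratedDeriv_of_eq_cpow (Complex.Gamma β) (α + β) _ (fun y hy => ?_) x hx
    rw [rlIntegral_powFun (re_add_floor_pos α) hβ hy]
    ring_nf

theorem rlPow_one (α β : ℂ) :
    rlPow α β 1 = Complex.Gamma β / Complex.Gamma (α + β) := by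
  rw [rlPow]
  split_ifs with h1
  · rw [rlOperator_powFun α h1 one_pos]
    simp [div_eq_mul_inv]
  · have h2 := re_add_floor_pos β
    rw [iteratedDeriv_of_eq_cpow (Complex.Gamma (β + (⌊-β.re⌋₊ + 1 : ℕ))) (α + β) _ (fun y hy => by
      rw [rlOperator_powFun α h2 hy]
      ring_nf) 1 one_pos]
    have := Complex.Gamma_ne_zero_of_re_pos h2
    rw [← mul_assoc, div_mul_cancel₀ _ this]
    simp [div_eq_mul_inv]

end

/-! ### The quadrature error -/

section

open PowerSeries

theorem step_isTheta (θ b : ℝ) :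
    (fun n : ℕ => (1 / ((n : ℝ) - θ)) ^ b) =Θ[atTop] fun n : ℕ => (n : ℝ) ^ (-b) := by
  have e : ∀ᶠ n : ℕ in atTop, 0 < (n : ℝ) - θ := by
    filter_upwards [tendsto_natCast_atTop_atTop.eventually_gt_atTop θ] with n hn using sub_pos.2 hn
  constructor
  · refine (sub_rpow_isBigO θ (-b)).congr' ?_ EventuallyEq.rfl
    filter_upwards [e] with n hn
    rw [one_div, Real.inv_rpow hn.le, Real.rpow_neg hn.le]
  · refine ((sub_rpow_isBigO θ b).inv_rev ?_).congr' ?_ ?_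
    · filter_upwards [e] with n hn h0
      exact absurd h0 (Real.rpow_pos_of_pos hn b).ne'
    · filter_upwards with n
      rw [Real.rpow_neg (by positivity)]
    · filter_upwards [e] with n hn
      rw [one_div, Real.inv_rpow hn.le]

theorem rpow_mul_rpow_eventuallyEq (x y : ℝ) :
    (fun n : ℕ => (n : ℝ) ^ x * (n : ℝ) ^ y) =ᶠ[atTop] fun n : ℕ => (n : ℝ) ^ (x + y) := by
  filter_upwards [eventually_gt_atTop 0] with n hn
  rw [← Real.rpow_add (by exact_mod_cast hn)]

theorem step_cpow_isTheta (θ : ℝ) (s : ℂ) :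
    (fun n : ℕ => ((1 / ((n : ℝ) - θ) : ℝ) : ℂ) ^ s) =Θ[atTop] fun n : ℕ => (n : ℝ) ^ (-s.re) := by
  refine IsTheta.trans (IsTheta.of_norm_eventuallyEq ?_) (step_isTheta θ s.re)
  filter_upwards [tendsto_natCast_atTop_atTop.eventually_gt_atTop θ] with n hn
  have h : 0 < 1 / ((n : ℝ) - θ) := one_div_pos.2 (sub_pos.2 hn)
  rw [Complex.norm_cpow_eq_rpow_re_of_pos h]

/-- The quadrature error in terms of the coefficients of a product of power series. -/
theorem powError_eq (Q : SCQ) (α β : ℂ) {n : ℕ}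
    (hn : Q.θ < n) :
    Q.powError α β (1 / (n - Q.θ)) n = ((1 / ((n : ℝ) - Q.θ) : ℝ) : ℂ) ^ (α + β - 1) *
      (coeff n ((PowerSeries.mk Q.ω) * PowerSeries.mk fun n : ℕ => powFun β n) -
        Complex.Gamma β / Complex.Gamma (α + β) * ((n - Q.θ : ℝ) : ℂ) ^ (α + β - 1)) := by
  have hr : 0 < (n : ℝ) - Q.θ := sub_pos.2 hn
  set h : ℝ := 1 / ((n : ℝ) - Q.θ) with hh
  have hpos : 0 < h := one_div_pos.2 hr
  have hh1 : ((n : ℝ) - Q.θ) * h = 1 := by rw [hh]; field_simp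
  have hh0 : (h : ℂ) ≠ 0 := by exact_mod_cast hpos.ne'
  have e1 : (h : ℂ) ^ (α + β - 1) * ((n - Q.θ : ℝ) : ℂ) ^ (α + β - 1) = 1 := by
    rw [← Complex.mul_cpow_ofReal_nonneg hpos.le hr.le, ← Complex.ofReal_mul, mul_comm, hh1]
    simp
  have e2 : (h : ℂ) ^ (α + β - 1) = (h : ℂ) ^ α * (h : ℂ) ^ (β - 1) := by
    rw [← Complex.cpow_add _ _ hh0]
    ring_nf
  have e3 : Q.node h n = 1 := hh1
  rw [mul_sub, mul_left_comm _ (_ / _), e1, mul_one, SCQ.powError, e3, rlPow_one α β]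
  congr 1
  rw [SCQ.convPart, e2, mul_assoc, coeff_mul, Finset.Nat.sum_antidiagonal_eq_sum_range_succ
    (fun i j => coeff i (PowerSeries.mk Q.ω) * coeff j (PowerSeries.mk fun n : ℕ => powFun β n)),
    Finset.mul_sum]
  rw [Finset.mul_sum, Finset.mul_sum]
  refine Finset.sum_congr rfl fun j hj => ?_
  have hj' : j ≤ n := Nat.lt_succ_iff.1 (Finset.mem_range.1 hj)
  -- The shift drops out of the sample points, so the convolution part is an ordinary Cauchy
  -- product.
  have e4 : Q.node h n + (Q.θ - j) * h = ((n - j : ℕ) : ℝ) * h := by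
    rw [SCQ.node, Nat.cast_sub hj']
    ring
  rw [e4, coeff_mk, coeff_mk, powFun, powFun, Complex.ofReal_mul,
    Complex.mul_cpow_ofReal_nonneg (by positivity) hpos.le]
  ring

/-- The data extracted from the condition on the generating function. -/
theorem exists_factored {Q : SCQ} {α : ℂ} (hω : Q.ConditionOmega α) :
    ∃ (l : ℕ) (z a : Fin (l + 1) → ℂ) (N : ℂ⟦X⟧), a 0 = α ∧
      Factored z a 0 N (PowerSeries.mk Q.ω) Q.genFun ∧
      ∀ θ : ℝ, ∃ F : ℂ → ℂ, AnalyticAt ℂ F 0 ∧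
        ∀ᶠ u : ℝ in 𝓝[>] 0, consFun α θ Q.genFun u = F u := by
  obtain ⟨l, sing, a, ν, hs0, ha0, hinj, hnorm, hν, -, -, hre, hfac⟩ := hω.factorization
  obtain ⟨N, hN, hNν⟩ := exists_fast_rep hν
  have hz : ∀ j, ‖(sing j)⁻¹‖ = 1 := fun j => by rw [norm_inv, hnorm, inv_one]
  have hzi : Function.Injective fun j => (sing j)⁻¹ := inv_injective.comp hinj
  have hz0 : (sing 0)⁻¹ = 1 := by rw [hs0, inv_one]
  have hw : ∀ ξ : ℂ, ‖ξ‖ < 1 →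
      Q.genFun ξ = ν ξ * ∏ j, (1 - (sing j)⁻¹ * ξ) ^ (-(a j)) := by
    intro ξ hξ
    rw [hfac ξ hξ]
    congr 1
    refine Finset.prod_congr rfl fun j _ => ?_
    rw [div_eq_inv_mul]
  have hrep : Rep (PowerSeries.mk Q.ω) Q.genFun := fun ξ hξ => by
    simpa [SCQ.genFun] using (hω.summable ξ hξ).hasSum
  refine ⟨l, fun j => (sing j)⁻¹, a, N, ha0, ⟨hz, hzi, hz0, hN, hrep, ?_, ?_⟩, fun θ => ?_⟩
  · refine hrep.unique ((hNν.mul (Rep.prod Finset.univ fun j _ => rep_negBin (hz j) (a j))).congr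
      fun ξ hξ => (hw ξ hξ).symm)
  · intro j
    rw [ha0]
    exact hre j
  · rw [← ha0]
    exact exists_analyticAt_consFun (hν 1 (by simp)) hz hzi hz0 hw θ

/-- The leading terms of the quadrature error. -/
theorem powError_isBigO {Q : SCQ} {l : ℕ} {z a : Fin (l + 1) → ℂ} {N : ℂ⟦X⟧}
    (H : Factored z a 0 N (PowerSeries.mk Q.ω) Q.genFun) {q : ℕ} {γ : ℂ}
    (hκ : (fun u : ℝ => consFun (a 0) Q.θ Q.genFun u - (1 + γ * (u : ℂ) ^ q)) =O[𝓝[>] 0]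
      fun u : ℝ => u ^ (q + 1))
    {β : ℂ} (hβ : ∀ m : ℕ, β ≠ -(m : ℂ)) :
    (fun n : ℕ => Q.powError (a 0) β (1 / (n - Q.θ)) n -
      ((1 / ((n : ℝ) - Q.θ) : ℝ) : ℂ) ^ (a 0 + β - 1) *
        (Complex.Gamma β * γ * bc (a 0 + β - q) n)) =O[atTop]
      fun n : ℕ => (n : ℝ) ^ (-((q + 1 : ℕ) : ℝ)) + (n : ℝ) ^ (-β.re) := by
  have h1 := (step_cpow_isTheta Q.θ (a 0 + β - 1)).1.mul (H.conv_isBigO hκ hβ)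
  refine h1.congr' ?_ ?_
  · filter_upwards [tendsto_natCast_atTop_atTop.eventually_gt_atTop Q.θ] with n hn
    rw [powError_eq Q (a 0) β hn]
    ring
  · filter_upwards [eventually_gt_atTop 0] with n hn
    have hn' : (0 : ℝ) < n := by exact_mod_cast hn
    rw [mul_add, ← Real.rpow_add hn', ← Real.rpow_add hn']
    simp only [Complex.add_re, Complex.sub_re, Complex.one_re]
    ring_nf

theorem rpow_add_rpow_isTheta_step (θ b : ℝ) (p : ℕ) :
    (fun n : ℕ => (n : ℝ) ^ (-(p : ℝ)) + (n : ℝ) ^ (-b)) =Θ[atTop]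
      fun n : ℕ => (1 / ((n : ℝ) - θ)) ^ b + (1 / ((n : ℝ) - θ)) ^ p := by
  have hb := step_isTheta θ b
  have hp := step_isTheta θ p
  simp only [Real.rpow_natCast] at hp
  have hpos : ∀ᶠ n : ℕ in atTop, 0 < 1 / ((n : ℝ) - θ) := by
    filter_upwards [tendsto_natCast_atTop_atTop.eventually_gt_atTop θ] with n hn
    exact one_div_pos.2 (sub_pos.2 hn)
  constructor
  · refine IsBigO.add (hp.2.trans (IsBigO.of_bound 1 ?_)) (hb.2.trans (IsBigO.of_bound 1 ?_))
    all_goals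
      filter_upwards [hpos] with n hn
      have h1 : 0 < (1 / ((n : ℝ) - θ)) ^ b := by positivity
      have h2 : 0 < (1 / ((n : ℝ) - θ)) ^ p := by positivity
      rw [Real.norm_of_nonneg (by positivity), Real.norm_of_nonneg (by positivity)]
      linarith
  · exact (hb.1.trans (isBigO_add_right _ _)).add (hp.1.trans (isBigO_add_left _ _))

theorem stable_of_factored {Q : SCQ} {l : ℕ} {z a : Fin (l + 1) → ℂ} {N : ℂ⟦X⟧}
    (H : Factored z a 0 N (PowerSeries.mk Q.ω) Q.genFun) : Q.Stable (a 0) := by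
  have h := H.bd.isBigO
  simp only [coeff_mk] at h
  refine h.trans (IsBigO.of_bound 1 ?_)
  filter_upwards [eventually_gt_atTop 0] with n hn
  rw [Complex.norm_natCast_cpow_of_pos hn, Real.norm_of_nonneg (by positivity)]
  simp

/-- In the γ term the exponents of h^(α+β-1) and of `bc (α + β - q) n` cancel to leave n^(-q);
everything else is of higher order or O(h^β). -/
theorem convergent_of_consistent {Q : SCQ} {l : ℕ} {z a : Fin (l + 1) → ℂ} {N : ℂ⟦X⟧}
    (H : Factored z a 0 N (PowerSeries.mk Q.ω) Q.genFun) {q : ℕ} {γ : ℂ}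
    (hκ : (fun u : ℝ => consFun (a 0) Q.θ Q.genFun u - (1 + γ * (u : ℂ) ^ q)) =O[𝓝[>] 0]
      fun u : ℝ => u ^ (q + 1)) : Q.ConvergentOfOrder (a 0) q := by
  intro β hβ
  have h1 := powError_isBigO H hκ hβ
  have h2 : (fun n : ℕ => ((1 / ((n : ℝ) - Q.θ) : ℝ) : ℂ) ^ (a 0 + β - 1) *
      (Complex.Gamma β * γ * bc (a 0 + β - q) n)) =O[atTop] fun n : ℕ => (n : ℝ) ^ (-(q : ℝ)) := by
    refine ((step_cpow_isTheta Q.θ (a 0 + β - 1)).1.mul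
      ((bc_isBigO (a 0 + β - q)).const_mul_left (Complex.Gamma β * γ))).trans_eventuallyEq
      ((rpow_mul_rpow_eventuallyEq _ _).trans ?_)
    refine Eventually.of_forall fun n => ?_
    simp only [Complex.add_re, Complex.sub_re, Complex.one_re, Complex.natCast_re]
    ring_nf
  have h3 : (fun n : ℕ => (n : ℝ) ^ (-((q + 1 : ℕ) : ℝ)) + (n : ℝ) ^ (-β.re)) =O[atTop]
      fun n : ℕ => (n : ℝ) ^ (-(q : ℝ)) + (n : ℝ) ^ (-β.re) :=
    ((rpow_isBigO_rpow (by push_cast; linarith)).trans (isBigO_add_left _ _)).add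
      (isBigO_add_right _ _)
  have h4 := (h1.trans h3).add (h2.trans (isBigO_add_left (-(q : ℝ)) (-β.re)))
  exact (h4.trans (rpow_add_rpow_isTheta_step Q.θ β.re q).1).congr_left fun n => by ring

/-- Convergence of higher order forces the leading error term of the consistency relation to
vanish. -/
theorem leading_term_eq_zero {Q : SCQ} {l : ℕ} {z a : Fin (l + 1) → ℂ} {N : ℂ⟦X⟧}
    (H : Factored z a 0 N (PowerSeries.mk Q.ω) Q.genFun) {q : ℕ} {γ : ℂ}
    (hκ : (fun u : ℝ => consFun (a 0) Q.θ Q.genFun u - (1 + γ * (u : ℂ) ^ q)) =O[𝓝[>] 0]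
      fun u : ℝ => u ^ (q + 1)) {p : ℕ} (hp : q < p) (hc : Q.ConvergentOfOrder (a 0) p) :
    γ = 0 := by
  set α := a 0 with hα
  -- The large real part makes O(h^β) negligible, and Im(α + β) = 1 keeps α + β - q off the poles of
  -- Γ, so that `bc (α + β - q) n` has exact order and the γ term cannot hide.
  let β : ℂ := ⟨p + 2, 1 - α.im⟩
  have hβ : ∀ m : ℕ, β ≠ -(m : ℂ) := by
    intro m h
    have := congrArg Complex.re h
    simp only [β, Complex.neg_re, Complex.natCast_re] at this
    have h1 : (0 : ℝ) ≤ p := by positivity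
    have h2 : (0 : ℝ) ≤ m := by positivity
    linarith
  have hs : ∀ m : ℕ, α + β - q ≠ -(m : ℂ) := by
    intro m h
    have := congrArg Complex.im h
    simp [β] at this
  have hpq : ((q + 1 : ℕ) : ℝ) ≤ p := by exact_mod_cast hp
  have hsum : (fun n : ℕ => (n : ℝ) ^ (-(p : ℝ)) + (n : ℝ) ^ (-β.re)) =O[atTop]
      fun n : ℕ => (n : ℝ) ^ (-((q + 1 : ℕ) : ℝ)) :=
    (rpow_isBigO_rpow (by linarith)).add (rpow_isBigO_rpow (by simp only [β]; linarith))
  have hsum' : (fun n : ℕ => (n : ℝ) ^ (-((q + 1 : ℕ) : ℝ)) + (n : ℝ) ^ (-β.re)) =O[atTop]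
      fun n : ℕ => (n : ℝ) ^ (-((q + 1 : ℕ) : ℝ)) :=
    (isBigO_refl _ _).add (rpow_isBigO_rpow (by simp only [β]; linarith))
  have h1 := (powError_isBigO H hκ hβ).trans hsum'
  have h2 := ((hc β hβ).trans (rpow_add_rpow_isTheta_step Q.θ β.re p).2).trans hsum
  have h3 := (h2.sub h1).congr_left (f₂ := fun n : ℕ =>
    ((1 / ((n : ℝ) - Q.θ) : ℝ) : ℂ) ^ (α + β - 1) *
        (Complex.Gamma β * γ * bc (α + β - q) n)) fun n => by ring
  by_contra hγ
  have hΓ := Complex.Gamma_ne_zero hβ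
  have hΓs := Complex.Gamma_ne_zero hs
  have h4 : (fun n : ℕ => (n : ℝ) ^ ((α + β - q).re - 1)) =O[atTop] bc (α + β - q) := by
    have t := (tendsto_bc hs).inv₀ (inv_ne_zero hΓs)
    have t1 := (t.isBigO_one ℂ).mul (isBigO_refl (bc (α + β - q)) atTop)
    have t2 : (fun n : ℕ => (n : ℝ) ^ ((α + β - q).re - 1)) =O[atTop]
        fun n : ℕ => (n : ℂ) ^ (α + β - q - 1) := by
      refine IsBigO.of_bound 1 ?_
      filter_upwards [eventually_gt_atTop 0] with n hn
      rw [Complex.norm_natCast_cpow_of_pos hn, Real.norm_of_nonneg (by positivity)]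
      simp
    refine t2.trans ?_
    have t3 := (tendsto_bc hs).eventually_ne (inv_ne_zero hΓs)
    have t4 : (fun n : ℕ => (bc (α + β - q) n / (n : ℂ) ^ (α + β - q - 1))⁻¹ * bc (α + β - q) n)
        =ᶠ[atTop] fun n : ℕ => (n : ℂ) ^ (α + β - q - 1) := by
      filter_upwards [t3] with n hn
      have : bc (α + β - q) n ≠ 0 := fun h => hn (by rw [h, zero_div])
      field_simp
    refine t4.symm.trans_isBigO (t1.trans (IsBigO.of_bound 1 (Eventually.of_forall fun n => ?_)))
    simp
  have h5 : (fun n : ℕ => (n : ℝ) ^ (-(q : ℝ))) =O[atTop]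
      fun n : ℕ => (n : ℝ) ^ (-((q + 1 : ℕ) : ℝ)) := by
    have t1 := (step_cpow_isTheta Q.θ (α + β - 1)).2.mul
      (h4.trans (isBigO_self_const_mul (mul_ne_zero hΓ hγ) _ atTop))
    refine ((rpow_mul_rpow_eventuallyEq _ _).symm.trans_isBigO t1).trans h3 |>.congr_left fun n => ?_
    simp only [Complex.add_re, Complex.sub_re, Complex.one_re, Complex.natCast_re]
    ring_nf
  have h6 := ((isBigO_refl (fun n : ℕ => (n : ℝ) ^ (q : ℝ)) atTop).mul h5).congr'
    (rpow_mul_rpow_eventuallyEq _ _) (rpow_mul_rpow_eventuallyEq _ _)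
  have h7 : Tendsto (fun n : ℕ => (n : ℝ) ^ ((q : ℝ) + -((q + 1 : ℕ) : ℝ))) atTop (𝓝 0) := by
    have : (q : ℝ) + -((q + 1 : ℕ) : ℝ) = -1 := by push_cast; ring
    rw [this]
    exact (tendsto_rpow_neg_atTop one_pos).comp tendsto_natCast_atTop_atTop
  have h8 := h6.trans_tendsto h7
  simp only [add_neg_cancel, Real.rpow_zero] at h8
  exact one_ne_zero (tendsto_nhds_unique tendsto_const_nhds h8)

end

end ConvQuad

/-! ### The equivalence -/

theorem theorem1 (α : ℂ) (Q : SCQ) (hω : Q.ConditionOmega α) (p : ℕ) :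
    Q.ConvergentOfOrder α p ↔ Q.Stable α ∧ Q.ConsistentOfOrder α p := by
  obtain ⟨l, z, a, N, rfl, H, hF⟩ := ConvQuad.exists_factored hω
  obtain ⟨F, hFa, hF⟩ := hF Q.θ
  have hcons : ∀ q : ℕ, Q.ConsistentOfOrder (a 0) q ↔
      (fun u : ℝ => F u - 1) =O[𝓝[>] 0] fun u : ℝ => u ^ q := by
    intro q
    refine (ConvQuad.consistent_iff (a 0) Q.θ Q.genFun q).trans (isBigO_congr ?_ EventuallyEq.rfl)
    filter_upwards [hF] with u hu
    rw [hu]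
  have hlead : ∀ q : ℕ, Q.ConsistentOfOrder (a 0) q → ∃ γ : ℂ,
      (fun u : ℝ => F u - (1 + γ * (u : ℂ) ^ q)) =O[𝓝[>] 0] (fun u : ℝ => u ^ (q + 1)) ∧
      (fun u : ℝ => ConvQuad.consFun (a 0) Q.θ Q.genFun u - (1 + γ * (u : ℂ) ^ q)) =O[𝓝[>] 0]
        fun u : ℝ => u ^ (q + 1) := by
    intro q hq
    obtain ⟨γ, hγ⟩ := ConvQuad.exists_leading_term hFa ((hcons q).1 hq)
    refine ⟨γ, hγ, hγ.congr' ?_ EventuallyEq.rfl⟩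
    filter_upwards [hF] with u hu
    rw [hu]
  constructor
  · intro hc
    refine ⟨ConvQuad.stable_of_factored H, ?_⟩
    -- Convergence of the full order p is used at each q < p: it removes the coefficient of u^q and
    -- so raises the order of consistency by one.
    have key : ∀ q ≤ p, Q.ConsistentOfOrder (a 0) q := by
      intro q
      induction q with
      | zero =>
        intro _
        -- Order 0 only asks that F - 1 be bounded near 0, which continuity gives.
        rw [hcons]
        simpa using ConvQuad.continuousAt_isBigO_one (f := fun u => F u - 1)
          (hFa.continuousAt.sub continuousAt_const)
      | succ q ih =>
        intro hq
        obtain ⟨γ, h1, h2⟩ := hlead q (ih (by lia))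
        rw [ConvQuad.leading_term_eq_zero H h2 hq hc] at h1
        rw [hcons]
        simpa using h1
    exact key p le_rfl
  · rintro ⟨-, hc⟩
    obtain ⟨γ, -, h2⟩ := hlead p hc
    exact ConvQuad.convergent_of_consistent H h2
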